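/- Let $\mathbb K$ be $\mathbb R$ or $\mathbb C$. A continuous linear operator $T$ on a topological vector space $X$ is hypercyclic if there is $x\in X$ (a hypercyclic vector for $T$) whose orbit $\{T^nx: n\ge 0\}$ is dense in $X$; put $M_T=\{c>0: cT\text{ is hypercyclic}\}$. A family of operators has a common hypercyclic vector if one vector is hypercyclic for every member of the family. For a bounded sequence $w=(w_n)_{n\in\mathbb Z}$ of non-zero scalars, the bilateral weighted shift $T_w$ is the bounded operator on $\ell_2(\mathbb Z)$ with $T_we_n=w_ne_{n-1}$ for all $n\in\mathbb Z$, where $(e_n)_{n\in\mathbb Z}$ is the canonical orthonormal basis. **Theorem.** (I) There is a bounded linear operator $S$ on $\ell_2$ with $M_S=\{1,2\}$. (II) There is a bounded linear operator $T$ on $\ell_2$ such that $M_T$ is the open interval $(1/2,2)$, but every $A\subseteq[0,\infty)$ for which the family $\{cT:c\in A\}$ has a common hypercyclic vector has Lebesgue measure zero. Moreover, on $\ell_2(\mathbb Z)$ these properties hold for the following bilateral weighted shifts $S=T_w$ in (I) and $T=T_v$ in (II), which are bounded and invertible. The sequence $w$: $w_n=1$ for $|n|\le1$, $w_n=\frac{n}{n-1}a_n$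 for $n\ge2$ and $w_n=\frac{n+1}{n}a_n$ for $n\le-2$, where, with $k$ ranging over the positive integers, $a_n=\frac18$ if $-3\cdot5^k\le n<-2\cdot5^k$ for some $k$; $a_n=8$ if $-4\cdot5^k\le n<-3\cdot5^k$ for some $k$; $a_n=\frac12$ if $2\cdot5^k<n\le4\cdot5^k$ for some $k$; $a_n=\frac14$ if $5^k<n\le2\cdot5^k$ for some $k$; $a_n=16$ if $4\cdot5^k<n\le5^{k+1}$ for some $k$; and $a_n=1$ otherwise. The sequence $v$: put $m_k=2^{3k^2}$, $I_k^-=\{n\in\mathbb N:\frac78m_k\le n<m_k\}$ and $I_k^+=\{n\in\mathbb N: m_k<n\le\frac98m_k\}$ for $k\ge1$. Then $v_n=2^8$ if $n\in I_k^-\cup(-I_k^+)$ for some $k\ge 1$; $v_n=2^{-8}$ if $n\in I_k^+\cup(-I_k^-)$ for some $k\ge 1$; and $v_n=1$ otherwise. -/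

import Mathlib

open scoped lp

/-- `x` is a hypercyclic vector for `T`: the orbit `{Tⁿ x : n ≥ 0}` is dense. -/
def IsHypercyclicVector {𝕜 E : Type*} [RCLike 𝕜] [TopologicalSpace E] [AddCommGroup E]
    [Module 𝕜 E] (T : E →L[𝕜] E) (x : E) : Prop :=
  Dense (Set.range fun n : ℕ => (T ^ n) x)

/-- `T` is hypercyclic: it has a hypercyclic vector. -/
def IsHypercyclic {𝕜 E : Type*} [RCLike 𝕜] [TopologicalSpace E] [AddCommGroup E]
    [Module 𝕜 E] (T : E →L[𝕜] E) : Prop :=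
  ∃ x : E, IsHypercyclicVector T x

/-- The set `M_T = {c > 0 : cT is hypercyclic}`. -/
def hypercyclicMultiples {𝕜 E : Type*} [RCLike 𝕜] [TopologicalSpace E] [AddCommGroup E]
    [IsTopologicalAddGroup E] [Module 𝕜 E] [ContinuousConstSMul 𝕜 E] (T : E →L[𝕜] E) : Set ℝ :=
  {c : ℝ | 0 < c ∧ IsHypercyclic ((c : 𝕜) • T)}

/-- The family `{cT : c ∈ A}` has a common hypercyclic vector. -/
def HasCommonHypercyclicVector {𝕜 E : Type*} [RCLike 𝕜] [TopologicalSpace E] [AddCommGroup E]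
    [IsTopologicalAddGroup E] [Module 𝕜 E] [ContinuousConstSMul 𝕜 E] (T : E →L[𝕜] E)
    (A : Set ℝ) : Prop :=
  ∃ x : E, ∀ c ∈ A, IsHypercyclicVector ((c : 𝕜) • T) x

/-- `T` is the bilateral weighted shift on `ℓ²(ℤ)` with weight sequence `w`:
`T eₙ = wₙ eₙ₋₁` for all `n ∈ ℤ`, where `(eₙ)` is the canonical orthonormal basis. -/
def IsBilateralWeightedShift {𝕜 : Type*} [RCLike 𝕜] (w : ℤ → ℝ)
    (T : ℓ²(ℤ, 𝕜) →L[𝕜] ℓ²(ℤ, 𝕜)) : Prop :=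
  ∀ n : ℤ, T (lp.single 2 n (1 : 𝕜)) = (w n : 𝕜) • lp.single 2 (n - 1) (1 : 𝕜)

open Classical in
/-- The auxiliary factors for the first weight sequence; in all ranges of `n` that are not listed
(`|n| ≤ 5`, `-2·5ᵏ ≤ n < -5ᵏ` and `-5ᵏ⁺¹ ≤ n < -4·5ᵏ`, `k ≥ 1`) the value is `1`. -/
noncomputable def factorI (n : ℤ) : ℝ :=
  if ∃ k : ℕ, 1 ≤ k ∧ -(3 * 5 ^ k) ≤ n ∧ n < -(2 * 5 ^ k) then 1 / 8
  else if ∃ k : ℕ, 1 ≤ k ∧ -(4 * 5 ^ k) ≤ n ∧ n < -(3 * 5 ^ k) then 8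
  else if ∃ k : ℕ, 1 ≤ k ∧ 2 * 5 ^ k < n ∧ n ≤ 4 * 5 ^ k then 1 / 2
  else if ∃ k : ℕ, 1 ≤ k ∧ 5 ^ k < n ∧ n ≤ 2 * 5 ^ k then 1 / 4
  else if ∃ k : ℕ, 1 ≤ k ∧ 4 * 5 ^ k < n ∧ n ≤ 5 ^ (k + 1) then 16
  else 1

/-- The first weight sequence. -/
noncomputable def weightI (n : ℤ) : ℝ :=
  if 2 ≤ n then (n : ℝ) / ((n : ℝ) - 1) * factorI n
  else if n ≤ -2 then ((n : ℝ) + 1) / (n : ℝ) * factorI n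
  else 1

/-- With `m = 2 ^ (3k²)`: the integers `n` with `7m/8 ≤ n < m`. -/
def blockLeft (k : ℕ) : Set ℤ :=
  {n : ℤ | 7 * 2 ^ (3 * k ^ 2) ≤ 8 * n ∧ n < 2 ^ (3 * k ^ 2)}

/-- With `m = 2 ^ (3k²)`: the integers `n` with `m < n ≤ 9m/8`. -/
def blockRight (k : ℕ) : Set ℤ :=
  {n : ℤ | 2 ^ (3 * k ^ 2) < n ∧ 8 * n ≤ 9 * 2 ^ (3 * k ^ 2)}

open Classical in
/-- The second weight sequence. -/
noncomputable def weightII (n : ℤ) : ℝ :=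
  if ∃ k : ℕ, 1 ≤ k ∧ (n ∈ blockLeft k ∨ -n ∈ blockRight k) then 2 ^ 8
  else if ∃ k : ℕ, 1 ≤ k ∧ (n ∈ blockRight k ∨ -n ∈ blockLeft k) then 1 / 2 ^ 8
  else 1

/-! For a bilateral shift let `β` be the partial products of the weights in both directions, with `β
0 = 1`. If the weights lie between two positive constants, then `cT` is hypercyclic exactly when `c
^ n * β n` and `(c ^ n)⁻¹ * β (-n)` can be made large at a common time `n` (Salas:
`IsWeightProduct.unbounded_of_isHypercyclic`, `IsWeightProduct.isHypercyclic_of_unbounded`). Both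
examples are designed through `β`.

Part (I). For `n ≥ 2`, `β n = n * 2 ^ (-V)` and `β (-n) = (n - 1) * 2 ^ R` with exponents `V`, `R`
between `0` and `n`. Hence the first quantity is bounded for `c < 1` and the second for `c > 2`.
Wherever `R > 0` one has `V = n`, so for `1 < c < 2` one of the two is bounded at each time
(`productI_bounded`). The linear factors rescue exactly the endpoints: `c = 1` where `V` vanishes,
`c = 2` at the summits of `R`.

Part (II). The logarithms of `β n` and `β (-n)` are tents of height `m` around `m = 2 ^ (3k²)`, zero
outside relative distance `1/8`. At `n = m` both products are `2 ^ m`, which gives the interval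
`(1/2, 2)`. For a common vector `x`, consider the times `n` at which some `(cT) ^ n x`, `c ∈ A`, is
within `1/2` of `e₀`. Comparing two coordinates shows that the difference of two such times is near
some `m` (`IsWeightProduct.ne_one_of_closeMultiples`). Since the blocks are sparse, at most `2 ^ l`
times lie near the `l`-th block after a fixed one (`card_le_two_pow_of_nearBlock`). Each time `n`
serves only a set of `c` of diameter `O(1/n)` (`IsWeightProduct.volume_closeMultiples_le`), so
Borel–Cantelli makes `A` null. -/

open Filter Topology

/-! ### Hypercyclicity: transitivity, the criterion, invariance under conjugation -/

section Hypercyclic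

variable {𝕜 E F : Type*} [RCLike 𝕜] [NormedAddCommGroup E] [NormedSpace 𝕜 E]
  [NormedAddCommGroup F] [NormedSpace 𝕜 F]

/-- The orbit of a hypercyclic vector visits every ball at arbitrarily late times. -/
theorem IsHypercyclicVector.exists_ge_norm_sub_lt [Nontrivial E] {T : E →L[𝕜] E} {x : E}
    (h : IsHypercyclicVector T x) (y : E) {ε : ℝ} (hε : 0 < ε) (N : ℕ) :
    ∃ n, N ≤ n ∧ ‖(T ^ n) x - y‖ < ε := by
  classical
  have hne : ∀ z : E, NeBot (𝓝[≠] z) := fun z => Module.punctured_nhds_neBot 𝕜 E z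
  -- A nontrivial space has no isolated points, so discarding the first `N` orbit points keeps the
  -- orbit dense.
  have hd := Dense.sdiff_finset h ((Finset.range N).image fun n => (T ^ n) x)
  obtain ⟨z, ⟨⟨n, rfl⟩, hz⟩, hzy⟩ := hd.exists_dist_lt y hε
  refine ⟨n, ?_, by rw [dist_comm, dist_eq_norm] at hzy; exact hzy⟩
  by_contra! hn
  exact hz (by simpa using ⟨n, hn, rfl⟩)

/-- Birkhoff's transitivity theorem. -/
theorem isHypercyclic_of_transitive [CompleteSpace E] [TopologicalSpace.SeparableSpace E]
    {T : E →L[𝕜] E}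
    (h : ∀ U V : Set E, IsOpen U → IsOpen V → U.Nonempty → V.Nonempty →
      ∃ n : ℕ, ∃ x ∈ U, (T ^ n) x ∈ V) : IsHypercyclic T := by
  have : SecondCountableTopology E := UniformSpace.secondCountable_of_separable E
  let B := TopologicalSpace.countableBasis E
  have hB := TopologicalSpace.isBasis_countableBasis E
  have : Countable B := (TopologicalSpace.countable_countableBasis E).to_subtype
  have hdense : Dense (⋂ V : B, ⋃ n : ℕ, (fun x => (T ^ n) x) ⁻¹' (V : Set E)) := by
    refine dense_iInter_of_isOpen (fun V => isOpen_iUnion fun n =>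
      (hB.isOpen V.2).preimage (T ^ n).continuous) fun V => ?_
    refine dense_iff_inter_open.2 fun U hU hUne => ?_
    obtain ⟨n, x, hx, hxV⟩ := h U V hU (hB.isOpen V.2) hUne
      (TopologicalSpace.nonempty_of_mem_countableBasis V.2)
    exact ⟨x, hx, Set.mem_iUnion.2 ⟨n, hxV⟩⟩
  obtain ⟨x, hx⟩ := hdense.nonempty
  refine ⟨x, dense_iff_inter_open.2 fun U hU ⟨u, hu⟩ => ?_⟩
  obtain ⟨V, hV, -, hVU⟩ := hB.exists_subset_of_mem_open hu hU
  obtain ⟨n, hn⟩ := Set.mem_iUnion.1 (Set.mem_iInter.1 hx ⟨V, hV⟩)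
  exact ⟨_, hVU hn, n, rfl⟩

/-- The hypercyclicity criterion for an operator with a right inverse. -/
theorem isHypercyclic_of_criterion [CompleteSpace E] [TopologicalSpace.SeparableSpace E]
    {T R : E →L[𝕜] E} (hTR : T * R = 1) {D : Set E} (hD : Dense D) (n : ℕ → ℕ)
    (hT : ∀ u ∈ D, Tendsto (fun k => (T ^ n k) u) atTop (𝓝 0))
    (hR : ∀ u ∈ D, Tendsto (fun k => (R ^ n k) u) atTop (𝓝 0)) : IsHypercyclic T := by
  refine isHypercyclic_of_transitive fun U V hU hV hUne hVne => ?_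
  obtain ⟨u, huU, huD⟩ := hD.inter_open_nonempty U hU hUne
  obtain ⟨v, hvV, hvD⟩ := hD.inter_open_nonempty V hV hVne
  have hpow : ∀ m : ℕ, T ^ m * R ^ m = 1 := by
    intro m
    induction m with
    | zero => simp
    | succ m ih => rw [pow_succ, pow_succ', mul_assoc, ← mul_assoc T, hTR, one_mul, ih]
  -- The point `u + R ^ n v` is a small perturbation of `u`, and `T ^ n` sends it to `T ^ n u + v`,
  -- close to `v`.
  have h1 : Tendsto (fun k => u + (R ^ n k) v) atTop (𝓝 u) := by
    simpa using (hR v hvD).const_add u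
  have h2 : Tendsto (fun k => (T ^ n k) (u + (R ^ n k) v)) atTop (𝓝 v) := by
    have : ∀ k, (T ^ n k) (u + (R ^ n k) v) = (T ^ n k) u + v := fun k => by
      rw [map_add, ← mul_apply_eq_comp, hpow, one_apply_eq_self]
    simp only [this]
    simpa using (hT u huD).add_const v
  obtain ⟨k, hk1, hk2⟩ := ((h1.eventually (hU.mem_nhds huU)).and
    (h2.eventually (hV.mem_nhds hvV))).exists
  exact ⟨n k, _, hk1, hk2⟩

theorem isHypercyclicVector_conj_iff (e : E ≃L[𝕜] F) (T : E →L[𝕜] E) (y : F) :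
    IsHypercyclicVector ((e : E →L[𝕜] F) ∘L T ∘L (e.symm : F →L[𝕜] E)) y ↔
      IsHypercyclicVector T (e.symm y) := by
  have hpow : ∀ n : ℕ, (((e : E →L[𝕜] F) ∘L T ∘L (e.symm : F →L[𝕜] E)) ^ n) y
      = e ((T ^ n) (e.symm y)) := by
    intro n
    induction n with
    | zero => simp
    | succ n ih => rw [pow_succ', mul_apply_eq_comp, ih, pow_succ']; simp
  have hrange : (Set.range fun n : ℕ => (((e : E →L[𝕜] F) ∘L T ∘L (e.symm : F →L[𝕜] E)) ^ n) y)
      = e.toHomeomorph '' Set.range fun n : ℕ => (T ^ n) (e.symm y) := by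
    rw [← Set.range_comp]
    exact congrArg Set.range (funext hpow)
  unfold IsHypercyclicVector
  rw [hrange, dense_iff_closure_eq, dense_iff_closure_eq, ← e.toHomeomorph.image_closure]
  constructor <;> intro h
  · rw [← e.toHomeomorph.preimage_image (closure _), h, Set.preimage_univ]
  · rw [h, Set.image_univ, e.toHomeomorph.range_coe]

theorem smul_conj (e : E ≃L[𝕜] F) (T : E →L[𝕜] E) (c : 𝕜) :
    c • ((e : E →L[𝕜] F) ∘L T ∘L (e.symm : F →L[𝕜] E))
      = (e : E →L[𝕜] F) ∘L (c • T) ∘L (e.symm : F →L[𝕜] E) := by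
  ext x; simp

theorem hypercyclicMultiples_conj (e : E ≃L[𝕜] F) (T : E →L[𝕜] E) :
    hypercyclicMultiples ((e : E →L[𝕜] F) ∘L T ∘L (e.symm : F →L[𝕜] E))
      = hypercyclicMultiples T := by
  ext c
  refine and_congr_right fun _ => ?_
  rw [smul_conj]
  constructor
  · rintro ⟨y, hy⟩
    exact ⟨_, (isHypercyclicVector_conj_iff e _ y).1 hy⟩
  · rintro ⟨x, hx⟩
    exact ⟨e x, (isHypercyclicVector_conj_iff e _ _).2 (by simpa using hx)⟩

theorem HasCommonHypercyclicVector.of_conj {e : E ≃L[𝕜] F} {T : E →L[𝕜] E} {A : Set ℝ}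
    (h : HasCommonHypercyclicVector ((e : E →L[𝕜] F) ∘L T ∘L (e.symm : F →L[𝕜] E)) A) :
    HasCommonHypercyclicVector T A := by
  obtain ⟨y, hy⟩ := h
  refine ⟨e.symm y, fun c hc => ?_⟩
  have := hy c hc
  rw [smul_conj] at this
  exact (isHypercyclicVector_conj_iff e _ y).1 this

end Hypercyclic

/-! ### Construction of shifts and of reindexing maps on `ℓ²` -/

section WeightedComposition

variable {𝕜 : Type*} [RCLike 𝕜]

/-- Bounded weighted composition operators on `ℓ²` exist. -/
theorem exists_weightedComposition {α β : Type*} (e : α ≃ β) (a : α → 𝕜) {C : ℝ}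
    (ha : ∀ i, ‖a i‖ ≤ C) :
    ∃ R : ℓ²(β, 𝕜) →L[𝕜] ℓ²(α, 𝕜), ∀ x i, R x i = a i * x (e i) := by
  have hC : ∀ i : α, 0 ≤ C := fun i => (norm_nonneg _).trans (ha i)
  have hle : ∀ (x : ℓ²(β, 𝕜)) i, ‖a i * x (e i)‖ ^ (2 : ENNReal).toReal
      ≤ C ^ (2 : ENNReal).toReal * ‖x (e i)‖ ^ (2 : ENNReal).toReal := fun x i => by
    rw [norm_mul, Real.mul_rpow (norm_nonneg _) (norm_nonneg _)]
    have := Real.rpow_le_rpow (norm_nonneg _) (ha i) (z := (2 : ENNReal).toReal) (by simp)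
    gcongr
  have hsum : ∀ x : ℓ²(β, 𝕜), Summable fun i => ‖x (e i)‖ ^ (2 : ENNReal).toReal := fun x =>
    (e.summable_iff (f := fun j => ‖x j‖ ^ (2 : ENNReal).toReal)).2
      ((lp.memℓp x).summable (by simp))
  have hsum' : ∀ x : ℓ²(β, 𝕜), Summable fun i => ‖a i * x (e i)‖ ^ (2 : ENNReal).toReal := fun x =>
    Summable.of_nonneg_of_le (fun i => by positivity) (hle x) ((hsum x).mul_left _)
  let L : ℓ²(β, 𝕜) →ₗ[𝕜] ℓ²(α, 𝕜) :=
    { toFun := fun x => ⟨fun i => a i * x (e i), memℓp_gen (hsum' x)⟩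
      map_add' := fun x y => by
        ext i; exact mul_add _ _ _
      map_smul' := fun c x => by
        ext i; exact mul_left_comm _ _ _ }
  -- The index type may be empty, and then `C` may be negative; hence the absolute value.
  refine ⟨L.mkContinuous |C| fun x => ?_, fun x i => rfl⟩
  refine lp.norm_le_of_tsum_le (by simp) (by positivity) ?_
  rw [Real.mul_rpow (by positivity) (norm_nonneg _), lp.norm_rpow_eq_tsum (by simp) x,
    ← e.tsum_eq, ← tsum_mul_left]
  refine (hsum' x).tsum_le_tsum (fun i => ?_) ((hsum x).mul_left _)
  rw [abs_of_nonneg (hC i)]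
  exact hle x i

/-- Reindexing `ℓ²` along an equivalence of the index types. -/
theorem nonempty_reindex {α β : Type*} (e : α ≃ β) : Nonempty (ℓ²(β, 𝕜) ≃L[𝕜] ℓ²(α, 𝕜)) := by
  obtain ⟨R, hR⟩ := exists_weightedComposition (𝕜 := 𝕜) e (fun _ => 1) (C := 1) (by simp)
  obtain ⟨S, hS⟩ := exists_weightedComposition (𝕜 := 𝕜) e.symm (fun _ => 1) (C := 1) (by simp)
  exact ⟨ContinuousLinearEquiv.equivOfInverse R S (fun x => by ext i; simp [hR, hS])
    (fun x => by ext i; simp [hR, hS])⟩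

theorem exists_invertible_shift {w : ℤ → ℝ} {δ C : ℝ} (hδ : 0 < δ) (hw : ∀ n, δ ≤ w n)
    (hw' : ∀ n, w n ≤ C) :
    ∃ T : ℓ²(ℤ, 𝕜) →L[𝕜] ℓ²(ℤ, 𝕜), (∀ x n, T x n = (w (n + 1) : 𝕜) * x (n + 1)) ∧ IsUnit T := by
  have hpos : ∀ n, 0 < w n := fun n => hδ.trans_le (hw n)
  obtain ⟨T, hT⟩ := exists_weightedComposition (𝕜 := 𝕜) (Equiv.addRight (1 : ℤ))
    (fun n => (w (n + 1) : 𝕜)) (C := C) fun n => by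
      rw [RCLike.norm_ofReal, abs_of_pos (hpos _)]; exact hw' _
  obtain ⟨R, hR⟩ := exists_weightedComposition (𝕜 := 𝕜) (Equiv.subRight (1 : ℤ))
    (fun n => ((w n)⁻¹ : 𝕜)) (C := δ⁻¹) fun n => by
      rw [norm_inv, RCLike.norm_ofReal, abs_of_pos (hpos _)]
      exact inv_anti₀ hδ (hw n)
  have hne : ∀ n, (w n : 𝕜) ≠ 0 := fun n => by exact_mod_cast (hpos n).ne'
  refine ⟨T, hT, ⟨⟨T, R, ?_, ?_⟩, rfl⟩⟩ <;> ext x n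
  · simp [hT, hR, hne]
  · simp [hT, hR, hne]

theorem isBilateralWeightedShift_of_apply {w : ℤ → ℝ} {T : ℓ²(ℤ, 𝕜) →L[𝕜] ℓ²(ℤ, 𝕜)}
    (hT : ∀ x n, T x n = (w (n + 1) : 𝕜) * x (n + 1)) : IsBilateralWeightedShift w T := by
  intro n
  ext i
  rw [hT, lp.coeFn_smul, Pi.smul_apply, lp.single_apply, lp.single_apply]
  by_cases h : i = n - 1
  · subst h; simp
  · have : i + 1 ≠ n := by omega
    simp [h, this]

end WeightedComposition

/-! ### Salas's characterisation of hypercyclic bilateral shifts -/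

section Shift

/-- `β` is the sequence of partial products of `w` in both directions, normalised by `β 0 = 1`. -/
structure IsWeightProduct (w β : ℤ → ℝ) : Prop where
  zero : β 0 = 1
  pos : ∀ n, 0 < β n
  succ : ∀ n, β (n + 1) = w (n + 1) * β n

variable {𝕜 : Type*} [RCLike 𝕜]

theorem topologicalClosure_span_single :
    (Submodule.span 𝕜 (Set.range fun j : ℤ =>
      (lp.single 2 j (1 : 𝕜) : ℓ²(ℤ, 𝕜)))).topologicalClosure = ⊤ := by
  have h := (HilbertBasis.ofRepr (LinearIsometryEquiv.refl 𝕜 ℓ²(ℤ, 𝕜))).dense_span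
  have hb : (fun j : ℤ => (lp.single 2 j (1 : 𝕜) : ℓ²(ℤ, 𝕜)))
      = HilbertBasis.ofRepr (LinearIsometryEquiv.refl 𝕜 ℓ²(ℤ, 𝕜)) :=
    funext fun j => HilbertBasis.repr_symm_single (HilbertBasis.ofRepr (LinearIsometryEquiv.refl 𝕜 ℓ²(ℤ, 𝕜))) j
  rw [hb]
  exact h

theorem dense_span_single :
    Dense (Submodule.span 𝕜 (Set.range fun j : ℤ =>
      (lp.single 2 j (1 : 𝕜) : ℓ²(ℤ, 𝕜))) : Set ℓ²(ℤ, 𝕜)) :=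
  Submodule.dense_iff_topologicalClosure_eq_top.2 topologicalClosure_span_single

instance separableSpace_l2 : TopologicalSpace.SeparableSpace ℓ²(ℤ, 𝕜) := by
  have h := (Set.countable_range fun j : ℤ =>
    (lp.single 2 j (1 : 𝕜) : ℓ²(ℤ, 𝕜))).isSeparable.span (R := 𝕜)
  rw [← TopologicalSpace.isSeparable_univ_iff]
  have h2 := h.closure
  rwa [dense_span_single.closure_eq] at h2

instance nontrivial_l2 : Nontrivial ℓ²(ℤ, 𝕜) := by
  refine ⟨0, lp.single 2 0 (1 : 𝕜), fun h => ?_⟩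
  have := congrArg norm h
  rw [norm_zero, lp.norm_single (by norm_num), norm_one] at this
  exact zero_ne_one this

variable {w β : ℤ → ℝ} {T : ℓ²(ℤ, 𝕜) →L[𝕜] ℓ²(ℤ, 𝕜)}

theorem IsWeightProduct.pow_apply (hβ : IsWeightProduct w β)
    (hT : ∀ x n, T x n = (w (n + 1) : 𝕜) * x (n + 1)) (c : ℝ) (m : ℕ) (x : ℓ²(ℤ, 𝕜)) (n : ℤ) :
    ((((c : 𝕜) • T) ^ m) x) n = ((c ^ m * (β (n + m) / β n) : ℝ) : 𝕜) * x (n + m) := by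
  induction m generalizing n with
  | zero => simp [div_self (hβ.pos n).ne']
  | succ m ih =>
    rw [pow_succ', mul_apply_eq_comp, smul_apply, lp.coeFn_smul,
      Pi.smul_apply, hT, ih, smul_eq_mul, ← mul_assoc, ← mul_assoc, ← RCLike.ofReal_mul,
      ← RCLike.ofReal_mul, show n + ((m + 1 : ℕ) : ℤ) = n + 1 + m by push_cast; ring]
    congr 2
    have h1 := (hβ.pos n).ne'
    have h2 := (hβ.pos (n + 1)).ne'
    have h3 := hβ.succ n
    field_simp
    rw [h3]; ring

theorem IsWeightProduct.pow_single (hβ : IsWeightProduct w β)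
    (hT : ∀ x n, T x n = (w (n + 1) : 𝕜) * x (n + 1)) (c : ℝ) (m : ℕ) (j : ℤ) :
    (((c : 𝕜) • T) ^ m) (lp.single 2 j (1 : 𝕜))
      = ((c ^ m * (β j / β (j - m)) : ℝ) : 𝕜) • lp.single 2 (j - m) (1 : 𝕜) := by
  ext n
  rw [hβ.pow_apply hT, lp.coeFn_smul, Pi.smul_apply, lp.single_apply, lp.single_apply]
  by_cases h : n = j - m
  · subst h; simp
  · have : n + m ≠ j := by omega
    simp [h, this]

/-- Salas's condition is necessary for hypercyclicity. -/
theorem IsWeightProduct.unbounded_of_isHypercyclic (hβ : IsWeightProduct w β)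
    (hT : ∀ x n, T x n = (w (n + 1) : 𝕜) * x (n + 1)) {c : ℝ} (hc : 0 < c)
    (h : IsHypercyclic ((c : 𝕜) • T)) (M : ℝ) :
    ∃ n : ℕ, M < c ^ n * β n ∧ M < (c ^ n)⁻¹ * β (-n) := by
  obtain ⟨x, hx⟩ := h
  -- With this choice `(1 - ε) / ε = |M| + 1`, which exceeds `M`.
  set ε : ℝ := 1 / (|M| + 2) with hε
  have hMpos : 0 < |M| + 2 := by positivity
  have hε0 : 0 < ε := by positivity
  have hkey : M * ε < 1 - ε := by
    have : (|M| + 2) * ε = 1 := by rw [hε]; field_simp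
    nlinarith [le_abs_self M]
  set e : ℓ²(ℤ, 𝕜) := lp.single 2 0 (1 : 𝕜) with he
  have he0 : e 0 = 1 := by simp [he]
  have he1 : ∀ n : ℤ, n ≠ 0 → e n = 0 := fun n hn => by simp [he, hn]
  -- The orbit comes close to `e₀` at time `p`, at a point `y`, and again `n` steps later.
  -- Coordinate `n` of `y` is small but becomes coordinate `0`, of size about `1`; coordinate `0` of
  -- `y` is about `1` but becomes coordinate `-n`, which is small. The two growth factors are the
  -- two quantities to be bounded below.
  obtain ⟨p, -, hp⟩ := hx.exists_ge_norm_sub_lt e hε0 0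
  obtain ⟨q, hq, hq'⟩ := hx.exists_ge_norm_sub_lt e hε0 (p + 1)
  obtain ⟨n, rfl⟩ : ∃ n, q = n + p := ⟨q - p, by omega⟩
  have hn : 0 < n := by omega
  set y := (((c : 𝕜) • T) ^ p) x with hy
  rw [pow_add, mul_apply_eq_comp, ← hy] at hq'
  have hcoord : ∀ (z : ℓ²(ℤ, 𝕜)) (i : ℤ), ‖z - e‖ < ε → ‖z i - e i‖ < ε := fun z i hz =>
    (lp.norm_apply_le_norm (by norm_num) (z - e) i).trans_lt hz
  have a0 := hcoord y 0 hp
  have an := hcoord y n hp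
  have b0 := hcoord _ 0 hq'
  have bn := hcoord _ (-n) hq'
  have hn' : (n : ℤ) ≠ 0 := by omega
  rw [he1 _ hn', sub_zero] at an
  rw [he1 _ (neg_ne_zero.2 hn'), sub_zero, hβ.pow_apply hT, norm_mul, RCLike.norm_ofReal,
    neg_add_cancel, hβ.zero] at bn
  rw [he0] at a0 b0
  have hcn : 0 < c ^ n := pow_pos hc n
  have hβ1 := hβ.pos n
  have hβ2 := hβ.pos (-n)
  have hrev : ∀ z : 𝕜, ‖z - 1‖ < ε → 1 - ε < ‖z‖ := fun z hz => by
    have := norm_sub_norm_le (1 : 𝕜) z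
    rw [norm_one, norm_sub_rev] at this
    linarith
  have a0' := hrev _ a0
  have b0' := hrev _ b0
  rw [hβ.pow_apply hT, norm_mul, RCLike.norm_ofReal, zero_add, hβ.zero, div_one,
    abs_of_pos (by positivity)] at b0'
  rw [abs_of_pos (by positivity)] at bn
  refine ⟨n, ?_, ?_⟩
  · by_contra! hle
    have : c ^ n * β n * ‖y n‖ ≤ M * ε := by
      have := mul_le_mul hle an.le (norm_nonneg _) ((by positivity : 0 < c ^ n * β n).le.trans hle)
      exact this
    linarith
  · by_contra! hle
    have h0 : 0 < (c ^ n)⁻¹ * β (-n) := by positivity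
    have h1 : ‖y 0‖ = ((c ^ n)⁻¹ * β (-n)) * (c ^ n * (1 / β (-n)) * ‖y 0‖) := by
      field_simp
    have : ‖y 0‖ ≤ M * ε := by
      rw [h1]
      exact mul_le_mul hle bn.le (by positivity) (h0.le.trans hle)
    linarith

/-- Salas's condition is sufficient for hypercyclicity. -/
theorem IsWeightProduct.isHypercyclic_of_unbounded (hβ : IsWeightProduct w β)
    (hT : ∀ x n, T x n = (w (n + 1) : 𝕜) * x (n + 1)) (hunit : IsUnit T) {δ C : ℝ} (hδ : 0 < δ)
    (hw : ∀ n, δ ≤ w n) (hw' : ∀ n, w n ≤ C) {c : ℝ} (hc : 0 < c)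
    (h : ∀ M : ℝ, ∃ n : ℕ, M ≤ c ^ n * β n ∧ M ≤ (c ^ n)⁻¹ * β (-n)) :
    IsHypercyclic ((c : 𝕜) • T) := by
  have hC : 0 < C := hδ.trans_le ((hw 0).trans (hw' 0))
  choose n hn1 hn2 using fun k : ℕ => h k
  have hup : ∀ i, δ * β i ≤ β (i + 1) := fun i => by
    rw [hβ.succ]; exact mul_le_mul_of_nonneg_right (hw _) (hβ.pos i).le
  have hdown : ∀ i, C⁻¹ * β i ≤ β (i - 1) := fun i => by
    have h1 := hβ.succ (i - 1)
    rw [sub_add_cancel] at h1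
    rw [inv_mul_le_iff₀ hC, h1]
    exact mul_le_mul_of_nonneg_right (hw' _) (hβ.pos _).le
  -- Moving the index of `β` by one costs at most a constant factor, `δ` upwards and `C⁻¹`
  -- downwards. So growth at the single index `0` spreads to every basis vector.
  have key : ∀ (s : ℕ → ℤ) (a : ℕ → ℝ), (∀ k, 0 < a k) →
      Tendsto (fun k => a k * β (s k)) atTop atTop →
      ∀ j : ℤ, Tendsto (fun k => a k * β (s k + j)) atTop atTop := by
    intro s a ha h0 j
    induction j using Int.induction_on with
    | zero => simpa using h0
    | succ i ih =>
      refine tendsto_atTop_mono (fun k => ?_) (ih.const_mul_atTop hδ)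
      rw [mul_left_comm, ← add_assoc]
      exact mul_le_mul_of_nonneg_left (hup _) (ha k).le
    | pred i ih =>
      refine tendsto_atTop_mono (fun k => ?_) (ih.const_mul_atTop (inv_pos.2 hC))
      rw [mul_left_comm, add_sub]
      exact mul_le_mul_of_nonneg_left (hdown _) (ha k).le
  have hpos := key (fun k => n k) (fun k => c ^ n k) (fun k => pow_pos hc _)
    (tendsto_atTop_mono hn1 tendsto_natCast_atTop_atTop)
  have hneg := key (fun k => -n k) (fun k => (c ^ n k)⁻¹) (fun k => inv_pos.2 (pow_pos hc _))
    (tendsto_atTop_mono hn2 tendsto_natCast_atTop_atTop)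
  have hc' : (c : 𝕜) ≠ 0 := by exact_mod_cast hc.ne'
  obtain ⟨u, hu⟩ : IsUnit ((c : 𝕜) • T) := by
    rw [← one_mul T, ← smul_mul_assoc, ← Algebra.algebraMap_eq_smul_one]
    exact ((Units.mk0 (c : 𝕜) hc').isUnit.map (algebraMap 𝕜 _)).mul hunit
  rw [← hu]
  have hsub : ∀ (A : ℕ → ℓ²(ℤ, 𝕜) →L[𝕜] ℓ²(ℤ, 𝕜)),
      (∀ j : ℤ, Tendsto (fun k => A k (lp.single 2 j (1 : 𝕜))) atTop (𝓝 0)) →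
      ∀ x ∈ Submodule.span 𝕜 (Set.range fun j : ℤ => (lp.single 2 j (1 : 𝕜) : ℓ²(ℤ, 𝕜))),
        Tendsto (fun k => A k x) atTop (𝓝 0) := by
    intro A hA x hx
    induction hx using Submodule.span_induction with
    | mem x hx => obtain ⟨j, rfl⟩ := hx; exact hA j
    | zero => simp
    | add x y _ _ hx hy => simpa using hx.add hy
    | smul a x _ hx => simpa using hx.const_smul a
  have hnorm : ∀ j : ℤ, ‖(lp.single 2 j (1 : 𝕜) : ℓ²(ℤ, 𝕜))‖ = 1 := fun j => by
    rw [lp.norm_single (by norm_num), norm_one]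
  refine isHypercyclic_of_criterion (D := (Submodule.span 𝕜 (Set.range fun j : ℤ =>
    (lp.single 2 j (1 : 𝕜) : ℓ²(ℤ, 𝕜))) : Set ℓ²(ℤ, 𝕜))) u.mul_inv dense_span_single n
    (hsub (fun k => (u : ℓ²(ℤ, 𝕜) →L[𝕜] ℓ²(ℤ, 𝕜)) ^ n k) fun j => ?_)
    (hsub (fun k => ((u⁻¹ : (ℓ²(ℤ, 𝕜) →L[𝕜] ℓ²(ℤ, 𝕜))ˣ) : ℓ²(ℤ, 𝕜) →L[𝕜] ℓ²(ℤ, 𝕜)) ^ n k)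
      fun j => ?_)
  · rw [tendsto_zero_iff_norm_tendsto_zero]
    have := (hneg j).inv_tendsto_atTop.const_mul (β j)
    rw [mul_zero] at this
    refine this.congr fun k => ?_
    have h1 := hβ.pos j
    have h2 := hβ.pos (j - n k)
    have h3 := pow_pos hc (n k)
    rw [hu, hβ.pow_single hT, norm_smul, hnorm, mul_one, RCLike.norm_ofReal,
      abs_of_pos (by positivity), Pi.inv_apply, neg_add_eq_sub]
    field_simp
  · rw [tendsto_zero_iff_norm_tendsto_zero]
    have := (hpos j).inv_tendsto_atTop.const_mul (β j)
    rw [mul_zero] at this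
    refine this.congr fun k => ?_
    have h1 := hβ.pos j
    have h2 := hβ.pos (j + n k)
    have h3 := pow_pos hc (n k)
    -- The norm of the inverse power at `eⱼ` is read off by applying that power to the formula for
    -- the forward image of the basis vector with index `j + n k`.
    have hps := hβ.pow_single hT c (n k) (j + n k)
    rw [add_sub_cancel_right, ← hu] at hps
    have hne : ((c ^ n k * (β (j + n k) / β j) : ℝ) : 𝕜) ≠ 0 := by
      have : c ^ n k * (β (j + n k) / β j) ≠ 0 := by positivity
      exact_mod_cast this
    have hinv : ((u⁻¹ : (ℓ²(ℤ, 𝕜) →L[𝕜] ℓ²(ℤ, 𝕜))ˣ) : ℓ²(ℤ, 𝕜) →L[𝕜] ℓ²(ℤ, 𝕜)) ^ n k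
        * (u : ℓ²(ℤ, 𝕜) →L[𝕜] ℓ²(ℤ, 𝕜)) ^ n k = 1 := by
      rw [← Units.val_pow_eq_pow_val, ← Units.val_pow_eq_pow_val, ← Units.val_mul, inv_pow,
        inv_mul_cancel, Units.val_one]
    have h4 := congrArg (fun z => (((u⁻¹ : (ℓ²(ℤ, 𝕜) →L[𝕜] ℓ²(ℤ, 𝕜))ˣ) :
      ℓ²(ℤ, 𝕜) →L[𝕜] ℓ²(ℤ, 𝕜)) ^ n k) z) hps
    simp only [← mul_apply_eq_comp, hinv, one_apply_eq_self, map_smul] at h4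
    have h5 := congrArg norm h4
    rw [norm_smul, hnorm, RCLike.norm_ofReal, abs_of_pos (by positivity)] at h5
    rw [Pi.inv_apply, add_comm (n k : ℤ) j]
    rw [eq_comm, ← mul_right_inj' (show c ^ n k * (β (j + n k) / β j) ≠ 0 by positivity), ← h5]
    field_simp

end Shift

/-! ### Superposition of bumps with disjoint supports -/

section DisjointSum

open Classical in
/-- The sum of the positive parts of the functions `t k`, `1 ≤ k`, when these have disjoint
supports. -/
noncomputable def disjointSum (t : ℕ → ℤ → ℤ) (n : ℤ) : ℤ :=
  if h : ∃ k, 1 ≤ k ∧ 0 < t k n then t h.choose n else 0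

variable {t : ℕ → ℤ → ℤ} {n : ℤ}

/-- Only strictly positive competitors need excluding. This permits endpoints of a support, where `t
k n = 0` and the formula of the block still holds. -/
theorem disjointSum_eq {k : ℕ} (hk : 1 ≤ k) (h0 : 0 ≤ t k n)
    (h : ∀ l, 1 ≤ l → 0 < t l n → l = k) : disjointSum t n = t k n := by
  unfold disjointSum
  split_ifs with hex
  · rw [h _ hex.choose_spec.1 hex.choose_spec.2]
  · push Not at hex
    exact le_antisymm h0 (hex k hk)

theorem disjointSum_eq_zero (h : ∀ l, 1 ≤ l → t l n ≤ 0) : disjointSum t n = 0 := by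
  unfold disjointSum
  rw [dif_neg]
  rintro ⟨k, hk, hk'⟩
  exact absurd (h k hk) (by omega)

theorem disjointSum_cases (t : ℕ → ℤ → ℤ) (n : ℤ) :
    disjointSum t n = 0 ∨ ∃ k, 1 ≤ k ∧ 0 < t k n ∧ disjointSum t n = t k n := by
  unfold disjointSum
  split_ifs with hex
  · exact Or.inr ⟨_, hex.choose_spec.1, hex.choose_spec.2, rfl⟩
  · exact Or.inl rfl

end DisjointSum

/-! ### The first weight: valleys on the right, ridges on the left -/

section FirstWeight

/-- The depth of the partial products of the factors `factorI` on the positive side. -/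
def valley (k : ℕ) (n : ℤ) : ℤ := min (2 * n - 2 * 5 ^ k) (min n (20 * 5 ^ k - 4 * n))

/-- The height of the partial products of the factors `factorI` on the negative side. -/
def ridge (k : ℕ) (n : ℤ) : ℤ := min (3 * n - 6 * 5 ^ k) (12 * 5 ^ k - 3 * n)

/-- The interval for `k` is closed and the one for `l` open, so a point shared by two consecutive
blocks is harmless: no bump is positive there. -/
theorem eq_of_mem_five_pow_interval {k l : ℕ} {n : ℤ} (h1 : 5 ^ k ≤ n) (h2 : n ≤ 5 * 5 ^ k)
    (h3 : 5 ^ l < n) (h4 : n < 5 * 5 ^ l) : l = k := by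
  rcases lt_trichotomy l k with h | h | h
  · have : (5 : ℤ) ^ (l + 1) ≤ 5 ^ k := pow_le_pow_right₀ (by norm_num) h
    rw [pow_succ'] at this
    omega
  · exact h
  · have : (5 : ℤ) ^ (k + 1) ≤ 5 ^ l := pow_le_pow_right₀ (by norm_num) h
    rw [pow_succ'] at this
    omega

theorem five_le_five_pow {k : ℕ} (hk : 1 ≤ k) : (5 : ℤ) ≤ 5 ^ k := by
  simpa using pow_le_pow_right₀ (by norm_num : (1 : ℤ) ≤ 5) hk

theorem valleySum_eq {k : ℕ} (hk : 1 ≤ k) {n : ℤ} (h1 : 5 ^ k ≤ n) (h2 : n ≤ 5 * 5 ^ k) :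
    disjointSum valley n = min (2 * n - 2 * 5 ^ k) (min n (20 * 5 ^ k - 4 * n)) := by
  have h5 := five_le_five_pow hk
  refine disjointSum_eq hk ?_ fun l _ hl => ?_
  · unfold valley; omega
  · unfold valley at hl
    exact eq_of_mem_five_pow_interval h1 h2 (by omega) (by omega)

theorem ridgeSum_eq {k : ℕ} (hk : 1 ≤ k) {n : ℤ} (h1 : 2 * 5 ^ k ≤ n) (h2 : n ≤ 4 * 5 ^ k) :
    disjointSum ridge n = min (3 * n - 6 * 5 ^ k) (12 * 5 ^ k - 3 * n) := by
  have h5 := five_le_five_pow hk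
  refine disjointSum_eq hk ?_ fun l hl' hl => ?_
  · unfold ridge; omega
  · unfold ridge at hl
    have h5' := five_le_five_pow hl'
    exact eq_of_mem_five_pow_interval (n := n) (by omega) (by omega) (by omega) (by omega)

theorem valleySum_of_nonpos {n : ℤ} (h : n ≤ 0) : disjointSum valley n = 0 :=
  disjointSum_eq_zero fun l _ => by unfold valley; omega

theorem ridgeSum_of_nonpos {n : ℤ} (h : n ≤ 0) : disjointSum ridge n = 0 :=
  disjointSum_eq_zero fun l hl => by
    have := five_le_five_pow hl
    unfold ridge; omega

/-- The binary logarithm of the partial products of the factors `factorI`. -/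
noncomputable def exponentI (n : ℤ) : ℤ := disjointSum ridge (-n - 1) - disjointSum valley n

/-- The slopes `2`, `1`, `-4` of a valley give, with reversed sign, the factors `1/4`, `1/2`, `16`.
The slopes `±3` of a ridge give `8` and `1/8`, with the argument running backwards from `-n` to `-n
- 1`. The exponent is a separate variable so that it can be computed by `omega` and then
substituted. -/
theorem factorI_eq_zpow {n : ℤ} {d : ℤ} (hd : d = exponentI n - exponentI (n - 1)) :
    factorI n = 2 ^ d := by
  unfold exponentI at hd
  rw [show -(n - 1) - 1 = -n by ring] at hd
  unfold factorI
  split_ifs with h1 h2 h3 h4 h5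
  · obtain ⟨k, hk, ha, hb⟩ := h1
    have h5 := five_le_five_pow hk
    rw [valleySum_of_nonpos (n := n) (by omega), valleySum_of_nonpos (n := n - 1) (by omega),
      ridgeSum_eq hk (n := -n - 1) (by omega) (by omega),
      ridgeSum_eq hk (n := -n) (by omega) (by omega)] at hd
    obtain rfl : d = -3 := by omega
    norm_num
  · obtain ⟨k, hk, ha, hb⟩ := h2
    have h5 := five_le_five_pow hk
    rw [valleySum_of_nonpos (n := n) (by omega), valleySum_of_nonpos (n := n - 1) (by omega),
      ridgeSum_eq hk (n := -n - 1) (by omega) (by omega),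
      ridgeSum_eq hk (n := -n) (by omega) (by omega)] at hd
    obtain rfl : d = 3 := by omega
    norm_num
  · obtain ⟨k, hk, ha, hb⟩ := h3
    have h5 := five_le_five_pow hk
    rw [ridgeSum_of_nonpos (n := -n - 1) (by omega), ridgeSum_of_nonpos (n := -n) (by omega),
      valleySum_eq hk (n := n) (by omega) (by omega),
      valleySum_eq hk (n := n - 1) (by omega) (by omega)] at hd
    obtain rfl : d = -1 := by omega
    norm_num
  · obtain ⟨k, hk, ha, hb⟩ := h4
    have h5 := five_le_five_pow hk
    rw [ridgeSum_of_nonpos (n := -n - 1) (by omega), ridgeSum_of_nonpos (n := -n) (by omega),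
      valleySum_eq hk (n := n) (by omega) (by omega),
      valleySum_eq hk (n := n - 1) (by omega) (by omega)] at hd
    obtain rfl : d = -2 := by omega
    norm_num
  · obtain ⟨k, hk, ha, hb⟩ := h5
    have h5 := five_le_five_pow hk
    rw [pow_succ'] at hb
    rw [ridgeSum_of_nonpos (n := -n - 1) (by omega), ridgeSum_of_nonpos (n := -n) (by omega),
      valleySum_eq hk (n := n) (by omega) (by omega),
      valleySum_eq hk (n := n - 1) (by omega) (by omega)] at hd
    obtain rfl : d = 4 := by omega
    norm_num
  · push Not at h1 h2 h3 h4 h5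
    have hv : ∀ m, n - 1 ≤ m → m ≤ n → disjointSum valley m = 0 := fun m hm hm' => by
      refine disjointSum_eq_zero fun l hl => ?_
      have h3 := h3 l hl
      have h4 := h4 l hl
      have h5 := h5 l hl
      rw [pow_succ'] at h5
      unfold valley
      omega
    have hr : ∀ m, -n - 1 ≤ m → m ≤ -n → disjointSum ridge m = 0 := fun m hm hm' => by
      refine disjointSum_eq_zero fun l hl => ?_
      have h1 := h1 l hl
      have h2 := h2 l hl
      unfold ridge
      omega
    rw [hv n (by omega) (by omega), hv (n - 1) (by omega) (by omega), hr (-n) (by omega) (by omega),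
      hr (-n - 1) (by omega) (by omega)] at hd
    obtain rfl : d = 0 := by omega
    norm_num

theorem factorI_mem (n : ℤ) : 1 / 8 ≤ factorI n ∧ factorI n ≤ 16 := by
  unfold factorI
  split_ifs <;> norm_num

theorem weightI_mem (n : ℤ) : 1 / 16 ≤ weightI n ∧ weightI n ≤ 32 := by
  obtain ⟨h1, h2⟩ := factorI_mem n
  have key : ∀ r : ℝ, 1 / 2 ≤ r → r ≤ 2 → 1 / 16 ≤ r * factorI n ∧ r * factorI n ≤ 32 :=
    fun r hr hr' => ⟨by nlinarith, by nlinarith⟩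
  unfold weightI
  split_ifs with hn hn'
  · have : (2 : ℝ) ≤ n := by exact_mod_cast hn
    exact key _ (by rw [le_div_iff₀ (by linarith)]; linarith)
      (by rw [div_le_iff₀ (by linarith)]; linarith)
  · have : (n : ℝ) ≤ -2 := by exact_mod_cast hn'
    exact key _ (by rw [le_div_iff_of_neg (by linarith)]; linarith)
      (by rw [div_le_iff_of_neg (by linarith)]; linarith)
  · norm_num

/-- The partial products of the first weight sequence. -/
noncomputable def productI (n : ℤ) : ℝ := ((max 1 (max n (-n - 1)) : ℤ) : ℝ) * 2 ^ exponentI n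

theorem isWeightProduct_productI : IsWeightProduct weightI productI where
  zero := by
    simp [productI, exponentI, valleySum_of_nonpos le_rfl, ridgeSum_of_nonpos (n := -1) (by norm_num)]
  pos n := by
    have : (0 : ℤ) < max 1 (max n (-n - 1)) := by omega
    have : (0 : ℝ) < ((max 1 (max n (-n - 1)) : ℤ) : ℝ) := by exact_mod_cast this
    unfold productI
    positivity
  succ n := by
    obtain ⟨m, rfl⟩ : ∃ m, n = m - 1 := ⟨n + 1, by ring⟩
    rw [sub_add_cancel]
    have hf := factorI_eq_zpow (n := m) rfl
    have hz : (2 : ℝ) ^ exponentI m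
        = 2 ^ (exponentI m - exponentI (m - 1)) * 2 ^ exponentI (m - 1) := by
      rw [← zpow_add₀ (by norm_num), sub_add_cancel]
    unfold productI
    rw [hz, ← hf]
    unfold weightI
    split_ifs with h1 h2
    · rw [show max 1 (max m (-m - 1)) = m by omega,
        show max 1 (max (m - 1) (-(m - 1) - 1)) = m - 1 by omega]
      have : (2 : ℝ) ≤ m := by exact_mod_cast h1
      have : (m : ℝ) - 1 ≠ 0 := by linarith
      push_cast
      field_simp
    · rw [show max 1 (max m (-m - 1)) = -m - 1 by omega,
        show max 1 (max (m - 1) (-(m - 1) - 1)) = -m by omega]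
      have : (m : ℝ) ≤ -2 := by exact_mod_cast h2
      have : (m : ℝ) ≠ 0 := by linarith
      push_cast
      field_simp
      ring
    · have hm : exponentI m = exponentI (m - 1) := by
        unfold exponentI
        have hr : ∀ s, s ≤ 3 → disjointSum ridge s = 0 := fun s hs =>
          disjointSum_eq_zero fun l hl => by
            have := five_le_five_pow hl
            unfold ridge; omega
        have hv : ∀ s, s ≤ 3 → disjointSum valley s = 0 := fun s hs =>
          disjointSum_eq_zero fun l hl => by
            have := five_le_five_pow hl
            unfold valley; omega
        rw [hr _ (by omega), hr _ (by omega), hv _ (by omega), hv _ (by omega)]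
      rw [hf, hm, show max 1 (max m (-m - 1)) = 1 by omega,
        show max 1 (max (m - 1) (-(m - 1) - 1)) = 1 by omega]
      simp

theorem productI_natCast {n : ℕ} (hn : 1 ≤ n) :
    productI n = n * 2 ^ (-disjointSum valley n) := by
  unfold productI exponentI
  rw [show max 1 (max (n : ℤ) (-n - 1)) = n by omega, ridgeSum_of_nonpos (by omega), zero_sub]
  simp

theorem productI_neg_natCast {n : ℕ} (hn : 2 ≤ n) :
    productI (-n) = ((n : ℝ) - 1) * 2 ^ disjointSum ridge (n - 1) := by
  unfold productI exponentI
  rw [show max 1 (max (-n : ℤ) (- -n - 1)) = n - 1 by omega, neg_neg,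
    valleySum_of_nonpos (by omega), sub_zero]
  simp

theorem valleySum_nonneg (n : ℤ) : 0 ≤ disjointSum valley n := by
  rcases disjointSum_cases valley n with h | ⟨k, -, h, h'⟩ <;> omega

theorem ridgeSum_nonneg (n : ℤ) : 0 ≤ disjointSum ridge n := by
  rcases disjointSum_cases ridge n with h | ⟨k, -, h, h'⟩ <;> omega

theorem valleySum_le {n : ℤ} (hn : 0 ≤ n) : disjointSum valley n ≤ n := by
  rcases disjointSum_cases valley n with h | ⟨k, -, h, h'⟩
  · omega
  · have : valley k n ≤ n := by unfold valley; omega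
    omega

theorem ridgeSum_le {n : ℤ} (hn : 0 ≤ n) : disjointSum ridge n ≤ n := by
  rcases disjointSum_cases ridge n with h | ⟨k, -, h, h'⟩
  · omega
  · have : ridge k n ≤ n := by unfold ridge at h ⊢; omega
    omega

theorem exists_forall_self_mul_pow_le {r : ℝ} (h0 : 0 ≤ r) (hr : r < 1) :
    ∃ M, ∀ n : ℕ, n * r ^ n ≤ M := by
  obtain ⟨M, hM⟩ := (tendsto_self_mul_const_pow_of_lt_one h0 hr).bddAbove_range
  exact ⟨M, fun n => hM ⟨n, rfl⟩⟩

/-- Salas's condition holds for the multiple `c` of the first shift only if `c` is `1` or `2`. -/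
theorem productI_bounded {c : ℝ} (hc : 0 < c) (hc1 : c ≠ 1) (hc2 : c ≠ 2) :
    ∃ M : ℝ, ∀ n : ℕ, c ^ n * productI n ≤ M ∨ (c ^ n)⁻¹ * productI (-n) ≤ M := by
  -- The linear factor on the negative side is `n - 1` only from `n = 2` on; the times `0` and `1`
  -- are absorbed in the bound.
  suffices ∃ M : ℝ, ∀ n : ℕ, 2 ≤ n → c ^ n * productI n ≤ M ∨ (c ^ n)⁻¹ * productI (-n) ≤ M by
    obtain ⟨M, hM⟩ := this
    refine ⟨max M (max (c ^ 0 * productI (0 : ℕ)) (c ^ 1 * productI (1 : ℕ))), fun n => ?_⟩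
    rcases Nat.lt_or_ge n 2 with h | h
    · left
      interval_cases n <;> simp
    · exact (hM n h).imp (fun h => h.trans (le_max_left _ _)) (fun h => h.trans (le_max_left _ _))
  have hpos : ∀ n : ℕ, 2 ≤ n → c ^ n * productI n ≤ n * c ^ n := fun n hn => by
    rw [productI_natCast (by omega), mul_comm]
    have := zpow_le_one_of_nonpos₀ (by norm_num : (1 : ℝ) ≤ 2)
      (neg_nonpos.2 (valleySum_nonneg n))
    have h2 := pow_pos hc n
    exact mul_le_mul_of_nonneg_right (mul_le_of_le_one_right (by positivity) this) h2.le
  rcases lt_or_gt_of_ne hc1 with h | h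
  · obtain ⟨M, hM⟩ := exists_forall_self_mul_pow_le hc.le h
    exact ⟨M, fun n hn => Or.inl ((hpos n hn).trans (hM n))⟩
  rcases lt_or_gt_of_ne hc2 with h' | h'
  · obtain ⟨M, hM⟩ := exists_forall_self_mul_pow_le (r := c / 2) (by positivity)
      (by linarith)
    obtain ⟨M', hM'⟩ := exists_forall_self_mul_pow_le (r := c⁻¹) (by positivity)
      (inv_lt_one_of_one_lt₀ h)
    refine ⟨max M M', fun n hn => ?_⟩
    -- Off the ridges the negative side is at most `n * c⁻¹ ^ n`. On the `k`-th ridge `2 * 5 ^ k < n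
    -- ≤ 4 * 5 ^ k`, where the valley has its full depth `n`, and the positive side equals `n * (c /
    -- 2) ^ n`.
    rcases disjointSum_cases ridge (n - 1) with h0 | ⟨k, hk, h0, -⟩
    · right
      refine le_trans ?_ ((hM' n).trans (le_max_right _ _))
      rw [productI_neg_natCast hn, h0, zpow_zero, mul_one, inv_pow, mul_comm]
      have := pow_pos hc n
      gcongr
      linarith
    · left
      refine le_trans (le_of_eq ?_) ((hM n).trans (le_max_left _ _))
      have h5 := five_le_five_pow hk
      unfold ridge at h0
      rw [productI_natCast (by omega), valleySum_eq hk (by omega) (by omega), min_eq_left (a := (n : ℤ)),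
        min_eq_right, zpow_neg, zpow_natCast, div_pow]
      · field_simp
      · omega
      · omega
  · obtain ⟨M, hM⟩ := exists_forall_self_mul_pow_le (r := 2 / c) (by positivity)
      (by rw [div_lt_one hc]; exact h')
    refine ⟨M, fun n hn => Or.inr (le_trans ?_ (hM n))⟩
    rw [productI_neg_natCast hn, div_pow]
    have h1 : (2 : ℝ) ^ disjointSum ridge (n - 1) ≤ 2 ^ (n : ℤ) :=
      zpow_le_zpow_right₀ (by norm_num) (by have := ridgeSum_le (n := n - 1) (by omega); omega)
    rw [zpow_natCast] at h1
    have := pow_pos hc n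
    have hn' : (2 : ℝ) ≤ n := by exact_mod_cast hn
    calc (c ^ n)⁻¹ * (((n : ℝ) - 1) * 2 ^ disjointSum ridge (n - 1))
        ≤ (c ^ n)⁻¹ * ((n : ℝ) * 2 ^ n) := by gcongr; linarith
      _ = n * (2 ^ n / c ^ n) := by ring

theorem exists_le_five_pow (M : ℝ) : ∃ k : ℕ, 1 ≤ k ∧ M ≤ 5 ^ k := by
  obtain ⟨k, hk⟩ := pow_unbounded_of_one_lt M (by norm_num : (1 : ℝ) < 5)
  exact ⟨k + 1, by omega, hk.le.trans (pow_le_pow_right₀ (by norm_num) (by omega))⟩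

theorem productI_unbounded_one (M : ℝ) :
    ∃ n : ℕ, M ≤ (1 : ℝ) ^ n * productI n ∧ M ≤ ((1 : ℝ) ^ n)⁻¹ * productI (-n) := by
  obtain ⟨k, hk, hM⟩ := exists_le_five_pow (M + 1)
  have h5 := five_le_five_pow hk
  have h5' : 5 ≤ 5 ^ k := by exact_mod_cast h5
  -- At `5 ^ k` two consecutive valleys meet at depth `0`, so only the linear factor remains on the
  -- right.
  refine ⟨5 ^ k, ?_, ?_⟩
  · rw [productI_natCast (by omega), valleySum_eq hk (by push_cast; omega) (by push_cast; omega)]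
    push_cast
    rw [min_eq_left (by omega)]
    simp
    linarith
  · rw [productI_neg_natCast (by omega)]
    have h1 := one_le_zpow₀ (by norm_num : (1 : ℝ) ≤ 2)
      (ridgeSum_nonneg (((5 ^ k : ℕ) : ℤ) - 1))
    have h2 : (5 : ℝ) ≤ 5 ^ k := by exact_mod_cast h5
    rw [one_pow, inv_one, one_mul]
    refine le_trans ?_ (le_mul_of_one_le_right ?_ h1)
    · push_cast; linarith
    · push_cast; linarith

theorem productI_unbounded_two (M : ℝ) :
    ∃ n : ℕ, M ≤ (2 : ℝ) ^ n * productI n ∧ M ≤ ((2 : ℝ) ^ n)⁻¹ * productI (-n) := by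
  obtain ⟨k, hk, hM⟩ := exists_le_five_pow M
  have h5 := five_le_five_pow hk
  have h5' : 5 ≤ 5 ^ k := by exact_mod_cast h5
  have h2 : (5 : ℝ) ≤ 5 ^ k := by exact_mod_cast h5
  -- The summit of the ridge lies at `n - 1 = 3 * 5 ^ k` and has height `n - 1`, so dividing by `2 ^
  -- n` loses only a factor `2` against the linear growth.
  refine ⟨3 * 5 ^ k + 1, ?_, ?_⟩
  · rw [productI_natCast (by omega)]
    have h1 := valleySum_le (n := ((3 * 5 ^ k + 1 : ℕ) : ℤ)) (by omega)
    rw [mul_left_comm, ← zpow_natCast, ← zpow_add₀ (by norm_num)]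
    refine le_trans ?_ (le_mul_of_one_le_right (by positivity)
      (one_le_zpow₀ (by norm_num) (by omega)))
    push_cast; linarith
  · rw [productI_neg_natCast (by omega), ridgeSum_eq hk (by push_cast; omega) (by push_cast; omega),
      show min (3 * (((3 * 5 ^ k + 1 : ℕ) : ℤ) - 1) - 6 * 5 ^ k)
        (12 * 5 ^ k - 3 * (((3 * 5 ^ k + 1 : ℕ) : ℤ) - 1)) = ((3 * 5 ^ k : ℕ) : ℤ) by
        push_cast; omega, zpow_natCast]
    push_cast
    rw [pow_succ]
    field_simp
    linarith

end FirstWeight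

theorem exists_shift_hypercyclicMultiples_eq_one_two (𝕜 : Type*) [RCLike 𝕜] :
    ∃ S : ℓ²(ℤ, 𝕜) →L[𝕜] ℓ²(ℤ, 𝕜), IsBilateralWeightedShift weightI S ∧ IsUnit S ∧
      hypercyclicMultiples S = {1, 2} := by
  have hw := fun n => (weightI_mem n).1
  have hw' := fun n => (weightI_mem n).2
  obtain ⟨S, hS, hunit⟩ := exists_invertible_shift (𝕜 := 𝕜) (by norm_num) hw hw'
  refine ⟨S, isBilateralWeightedShift_of_apply hS, hunit, ?_⟩
  ext c
  simp only [hypercyclicMultiples, Set.mem_ofPred_eq, Set.mem_insert_iff, Set.mem_singleton_iff]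
  constructor
  · rintro ⟨hc, h⟩
    by_contra! hne
    obtain ⟨M, hM⟩ := productI_bounded hc hne.1 hne.2
    obtain ⟨n, h1, h2⟩ := isWeightProduct_productI.unbounded_of_isHypercyclic hS hc h M
    rcases hM n with h | h <;> linarith
  · rintro (rfl | rfl)
    · exact ⟨one_pos, isWeightProduct_productI.isHypercyclic_of_unbounded hS hunit (by norm_num)
        hw hw' one_pos productI_unbounded_one⟩
    · exact ⟨two_pos, isWeightProduct_productI.isHypercyclic_of_unbounded hS hunit (by norm_num)
        hw hw' two_pos productI_unbounded_two⟩

/-! ### The second weight: sparse symmetric tents -/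

section SecondWeight

/-- The binary logarithm of the partial products of the second weight sequence near the `k`-th
block. -/
def tent (k : ℕ) (n : ℤ) : ℤ := min (8 * n - 7 * 2 ^ (3 * k ^ 2) + 8) (9 * 2 ^ (3 * k ^ 2) - 8 * n)

/-- Divisibility by `8` makes the block ends `7m/8` and `9m/8` integers, which the integer
arithmetic at the feet of the tents relies on. -/
theorem exists_two_pow_eq {k : ℕ} (hk : 1 ≤ k) : ∃ q : ℕ, 1 ≤ q ∧ 2 ^ (3 * k ^ 2) = 8 * q := by
  obtain ⟨j, rfl⟩ : ∃ j, k = j + 1 := ⟨k - 1, by omega⟩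
  refine ⟨2 ^ (3 * (j ^ 2 + 2 * j)), Nat.one_le_two_pow, ?_⟩
  rw [show 3 * (j + 1) ^ 2 = 3 + 3 * (j ^ 2 + 2 * j) by ring, pow_add]
  norm_num

theorem exists_two_pow_eq_int {k : ℕ} (hk : 1 ≤ k) :
    ∃ q : ℤ, 1 ≤ q ∧ (2 : ℤ) ^ (3 * k ^ 2) = 8 * q := by
  obtain ⟨q, hq, h⟩ := exists_two_pow_eq hk
  exact ⟨q, by exact_mod_cast hq, by exact_mod_cast h⟩

/-- The exponents differ by `3 * (l ^ 2 - k ^ 2) ≥ 9`. -/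
theorem two_pow_separated {k l : ℕ} (hk : 1 ≤ k) (hkl : k < l) :
    512 * 2 ^ (3 * k ^ 2) ≤ 2 ^ (3 * l ^ 2) := by
  rw [show 512 = 2 ^ 9 by norm_num, ← pow_add]
  exact Nat.pow_le_pow_right (by norm_num) (by nlinarith)

theorem two_pow_separated_int {k l : ℕ} (hk : 1 ≤ k) (hkl : k < l) :
    (512 : ℤ) * 2 ^ (3 * k ^ 2) ≤ 2 ^ (3 * l ^ 2) := by
  exact_mod_cast two_pow_separated hk hkl

/-- The range begins one step before the block, where the tent is `0`, so that increments can be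
computed at the first point of the block. -/
theorem tentSum_eq {k : ℕ} (hk : 1 ≤ k) {n : ℤ} (h1 : 7 * 2 ^ (3 * k ^ 2) - 8 ≤ 8 * n)
    (h2 : 8 * n ≤ 9 * 2 ^ (3 * k ^ 2)) :
    disjointSum tent n = min (8 * n - 7 * 2 ^ (3 * k ^ 2) + 8) (9 * 2 ^ (3 * k ^ 2) - 8 * n) := by
  refine disjointSum_eq hk ?_ fun l hl h => ?_
  · unfold tent; omega
  · unfold tent at h
    obtain ⟨q, hq, hq'⟩ := exists_two_pow_eq_int hk
    obtain ⟨r, hr, hr'⟩ := exists_two_pow_eq_int hl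
    rcases lt_trichotomy l k with hlk | hlk | hlk
    · have := two_pow_separated_int hl hlk
      omega
    · exact hlk
    · have := two_pow_separated_int hk hlk
      omega

theorem tentSum_of_nonpos {n : ℤ} (hn : n ≤ 0) : disjointSum tent n = 0 :=
  disjointSum_eq_zero fun l hl => by
    obtain ⟨r, hr, hr'⟩ := exists_two_pow_eq_int hl
    unfold tent
    omega

theorem tentSum_eq_pred {n : ℤ} (h : ∀ k, 1 ≤ k → n ∉ blockLeft k ∧ n ∉ blockRight k) :
    disjointSum tent n = disjointSum tent (n - 1) := by
  simp only [blockLeft, blockRight, Set.mem_ofPred_eq] at h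
  -- The centre `m` belongs to neither half of its block: the tent has a flat top of height `m` on
  -- `{m - 1, m}`. At any other admissible `n`, both values vanish.
  by_cases hex : ∃ k, 1 ≤ k ∧ n = 2 ^ (3 * k ^ 2)
  · obtain ⟨k, hk, hn⟩ := hex
    obtain ⟨q, hq, hq'⟩ := exists_two_pow_eq_int hk
    rw [tentSum_eq hk (by omega) (by omega), tentSum_eq hk (by omega) (by omega)]
    omega
  · push Not at hex
    rw [disjointSum_eq_zero, disjointSum_eq_zero] <;>
    · intro l hl
      have h1 := h l hl
      have h2 := hex l hl
      obtain ⟨q, hq, hq'⟩ := exists_two_pow_eq_int hl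
      unfold tent
      rw [hq'] at h1 h2 ⊢
      omega

theorem tentSum_sub_of_mem_blockLeft {k : ℕ} (hk : 1 ≤ k) {n : ℤ} (hn : n ∈ blockLeft k) :
    0 < n ∧ disjointSum tent n - disjointSum tent (n - 1) = 8 := by
  obtain ⟨h1, h2⟩ := hn
  obtain ⟨q, hq, hq'⟩ := exists_two_pow_eq_int hk
  rw [tentSum_eq hk (n := n) (by omega) (by omega), tentSum_eq hk (n := n - 1) (by omega) (by omega)]
  omega

theorem tentSum_sub_of_mem_blockRight {k : ℕ} (hk : 1 ≤ k) {n : ℤ} (hn : n ∈ blockRight k) :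
    0 < n ∧ disjointSum tent n - disjointSum tent (n - 1) = -8 := by
  obtain ⟨h1, h2⟩ := hn
  obtain ⟨q, hq, hq'⟩ := exists_two_pow_eq_int hk
  rw [tentSum_eq hk (n := n) (by omega) (by omega), tentSum_eq hk (n := n - 1) (by omega) (by omega)]
  omega

/-- The binary logarithm of the partial products of the second weight sequence. -/
noncomputable def exponentII (n : ℤ) : ℤ := disjointSum tent n + disjointSum tent (-n - 1)

theorem weightII_eq_zpow {n : ℤ} {d : ℤ} (hd : d = exponentII n - exponentII (n - 1)) :
    weightII n = 2 ^ d := by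
  unfold exponentII at hd
  rw [show -(n - 1) - 1 = -n by ring] at hd
  unfold weightII
  split_ifs with h1 h2
  · obtain ⟨k, hk, h | h⟩ := h1
    · obtain ⟨h0, h⟩ := tentSum_sub_of_mem_blockLeft hk h
      rw [tentSum_of_nonpos (n := -n) (by omega), tentSum_of_nonpos (n := -n - 1) (by omega)] at hd
      obtain rfl : d = 8 := by omega
      norm_num
    · obtain ⟨h0, h⟩ := tentSum_sub_of_mem_blockRight hk h
      rw [tentSum_of_nonpos (n := n) (by omega), tentSum_of_nonpos (n := n - 1) (by omega)] at hd
      obtain rfl : d = 8 := by omega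
      norm_num
  · obtain ⟨k, hk, h | h⟩ := h2
    · obtain ⟨h0, h⟩ := tentSum_sub_of_mem_blockRight hk h
      rw [tentSum_of_nonpos (n := -n) (by omega), tentSum_of_nonpos (n := -n - 1) (by omega)] at hd
      obtain rfl : d = -8 := by omega
      norm_num
    · obtain ⟨h0, h⟩ := tentSum_sub_of_mem_blockLeft hk h
      rw [tentSum_of_nonpos (n := n) (by omega), tentSum_of_nonpos (n := n - 1) (by omega)] at hd
      obtain rfl : d = -8 := by omega
      norm_num
  · push Not at h1 h2
    rw [tentSum_eq_pred (n := n) fun k hk => ⟨(h1 k hk).1, (h2 k hk).1⟩,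
      tentSum_eq_pred (n := -n) fun k hk => ⟨(h2 k hk).2, (h1 k hk).2⟩] at hd
    obtain rfl : d = 0 := by omega
    norm_num

theorem weightII_mem (n : ℤ) : 1 / 2 ^ 8 ≤ weightII n ∧ weightII n ≤ 2 ^ 8 := by
  unfold weightII
  split_ifs <;> norm_num

/-- The partial products of the second weight sequence. -/
noncomputable def productII (n : ℤ) : ℝ := 2 ^ exponentII n

theorem isWeightProduct_productII : IsWeightProduct weightII productII where
  zero := by
    simp [productII, exponentII, tentSum_of_nonpos le_rfl, tentSum_of_nonpos (n := -1) (by norm_num)]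
  pos n := by
    unfold productII
    positivity
  succ n := by
    rw [weightII_eq_zpow rfl, productII, productII, ← zpow_add₀ (by norm_num), add_sub_cancel_right,
      sub_add_cancel]

theorem exponentII_natCast (n : ℕ) : exponentII n = disjointSum tent n := by
  unfold exponentII
  rw [tentSum_of_nonpos (n := -n - 1) (by omega), add_zero]

theorem exponentII_neg_natCast (n : ℕ) : exponentII (-n) = disjointSum tent (n - 1) := by
  unfold exponentII
  rw [tentSum_of_nonpos (n := -n) (by omega), zero_add, neg_neg]

/-- Equality holds at `n = m - 1`. On the negative side, where the argument is `n - 1`, the bound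
becomes `n`. -/
theorem tentSum_le {n : ℤ} (hn : -1 ≤ n) : disjointSum tent n ≤ n + 1 := by
  rcases disjointSum_cases tent n with h | ⟨k, -, h, h'⟩
  · omega
  · have : tent k n ≤ n + 1 := by unfold tent at h ⊢; omega
    omega

/-- Salas's condition holds for the multiple `c` of the second shift only if `1 / 2 < c < 2`. -/
theorem productII_bounded {c : ℝ} (hc : 0 < c) (h : c ≤ 1 / 2 ∨ 2 ≤ c) :
    ∃ M : ℝ, ∀ n : ℕ, c ^ n * productII n ≤ M ∨ (c ^ n)⁻¹ * productII (-n) ≤ M := by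
  rcases h with h | h
  · refine ⟨2, fun n => Or.inl ?_⟩
    rw [productII, exponentII_natCast]
    have h1 : (2 : ℝ) ^ disjointSum tent n ≤ 2 ^ ((n + 1 : ℕ) : ℤ) :=
      zpow_le_zpow_right₀ (by norm_num) (by have := tentSum_le (n := n) (by omega); omega)
    rw [zpow_natCast] at h1
    calc c ^ n * (2 : ℝ) ^ disjointSum tent n ≤ (1 / 2) ^ n * 2 ^ (n + 1) := by gcongr
      _ = 2 := by rw [pow_succ, ← mul_assoc, ← mul_pow]; norm_num
  · refine ⟨1, fun n => Or.inr ?_⟩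
    rw [productII, exponentII_neg_natCast]
    have h1 : (2 : ℝ) ^ disjointSum tent (n - 1) ≤ 2 ^ (n : ℤ) :=
      zpow_le_zpow_right₀ (by norm_num) (by have := tentSum_le (n := n - 1) (by omega); omega)
    rw [zpow_natCast] at h1
    rw [inv_mul_le_iff₀ (by positivity), mul_one]
    exact h1.trans (pow_le_pow_left₀ (by norm_num) h n)

theorem productII_unbounded {c : ℝ} (hc : 1 / 2 < c) (hc2 : c < 2) (M : ℝ) :
    ∃ n : ℕ, M ≤ c ^ n * productII n ∧ M ≤ (c ^ n)⁻¹ * productII (-n) := by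
  have h0 : 0 < c := by linarith
  have h1 := (tendsto_pow_atTop_atTop_of_one_lt
    (show (1 : ℝ) < c * 2 by linarith)).eventually_ge_atTop M
  have h2 := (tendsto_pow_atTop_atTop_of_one_lt
    (show (1 : ℝ) < c⁻¹ * 2 by rw [lt_inv_mul_iff₀ h0]; linarith)).eventually_ge_atTop M
  obtain ⟨N, hN⟩ := eventually_atTop.1 (h1.and h2)
  -- At time `m` the two sides see the tent at `m` and at `m - 1`, the two points of its flat top,
  -- so both products equal `2 ^ m`.
  set m := 2 ^ (3 * (N + 1) ^ 2) with hm
  have hNm : N ≤ m := by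
    have := Nat.lt_two_pow_self (n := 3 * (N + 1) ^ 2)
    nlinarith
  obtain ⟨h1, h2⟩ := hN m hNm
  obtain ⟨q, hq, hq'⟩ := exists_two_pow_eq_int (k := N + 1) (by omega)
  have hm' : (m : ℤ) = 2 ^ (3 * (N + 1) ^ 2) := by rw [hm]; push_cast; rfl
  refine ⟨m, ?_, ?_⟩
  · rw [productII, exponentII_natCast, tentSum_eq (k := N + 1) (by omega) (by omega) (by omega),
      min_eq_right (by omega), ← hm', show 9 * (m : ℤ) - 8 * m = m by ring, zpow_natCast,
      ← mul_pow]
    exact h1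
  · rw [productII, exponentII_neg_natCast, tentSum_eq (k := N + 1) (by omega) (by omega) (by omega),
      min_eq_left (by omega), ← hm', show 8 * ((m : ℤ) - 1) - 7 * m + 8 = m by ring, zpow_natCast,
      ← inv_pow, ← mul_pow]
    exact h2

end SecondWeight

/-! ### Common hypercyclic vectors exist only for null sets of multiples -/

section NullSet

/-- `j` has distance at most `m / 8` from `m = 2 ^ (3k²)`. -/
def NearBlock (k j : ℕ) : Prop := 7 * 2 ^ (3 * k ^ 2) ≤ 8 * j ∧ 8 * j ≤ 9 * 2 ^ (3 * k ^ 2)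

/-- The supports on the two sides differ by a shift of one, but since `8` divides `m` both fit into
the same closed range. -/
theorem exists_nearBlock {j : ℕ} (h : productII j ≠ 1 ∨ productII (-j) ≠ 1) :
    ∃ k, 1 ≤ k ∧ NearBlock k j := by
  have key : ∀ i : ℤ, (i = j ∨ i = j - 1) → disjointSum tent i ≠ 0 →
      ∃ k, 1 ≤ k ∧ NearBlock k j := by
    intro i hi hne
    obtain h | ⟨k, hk, hpos, -⟩ := disjointSum_cases tent i
    · exact absurd h hne
    refine ⟨k, hk, ?_⟩
    obtain ⟨q, hq, hq'⟩ := exists_two_pow_eq hk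
    have hq'' : (2 : ℤ) ^ (3 * k ^ 2) = 8 * q := by exact_mod_cast hq'
    unfold tent at hpos
    unfold NearBlock
    rw [hq'] at *
    rw [hq''] at hpos
    omega
  rcases h with h | h
  · refine key j (Or.inl rfl) fun h0 => h ?_
    rw [productII, exponentII_natCast, h0, zpow_zero]
  · refine key (j - 1) (Or.inr rfl) fun h0 => h ?_
    rw [productII, exponentII_neg_natCast, h0, zpow_zero]

/-- A set of integers all of whose differences are near one of `L` blocks has at most `2 ^ L`
elements. -/
theorem card_le_two_pow_of_nearBlock (L : ℕ) (S : Finset ℕ)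
    (h : ∀ a ∈ S, ∀ b ∈ S, a < b → ∃ k, 1 ≤ k ∧ k ≤ L ∧ NearBlock k (b - a)) :
    S.card ≤ 2 ^ L := by
  classical
  induction L generalizing S with
  | zero =>
    rw [pow_zero, Finset.card_le_one]
    intro a ha b hb
    rcases lt_trichotomy a b with hab | hab | hab
    · obtain ⟨k, h1, h2, -⟩ := h a ha b hb hab; omega
    · exact hab
    · obtain ⟨k, h1, h2, -⟩ := h b hb a ha hab; omega
  | succ L ih =>
    rcases S.eq_empty_or_nonempty with rfl | hne
    · simp
    set a := S.min' hne with ha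
    have haS : a ∈ S := S.min'_mem hne
    have hmin : ∀ b ∈ S, a ≤ b := fun b hb => S.min'_le b hb
    -- Split by whether the distance to the minimum `a` is near the top block, with centre `m`. Two
    -- points of the first kind differ by at most `m / 4`. A point of the second kind is near a
    -- lower block relative to `a`, hence much closer to `a` than `m`. So neither part has a
    -- difference near the top block.
    rw [← Finset.card_filter_add_card_filter_not (s := S) (fun b => NearBlock (L + 1) (b - a)),
      pow_succ, mul_two]
    have hpos : 0 < 2 ^ (3 * (L + 1) ^ 2) := by positivity
    refine add_le_add (ih _ fun b hb c hc hbc => ?_) (ih _ fun b hb c hc hbc => ?_)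
    · rw [Finset.mem_filter] at hb hc
      obtain ⟨k, h1, h2, h3⟩ := h b hb.1 c hc.1 hbc
      refine ⟨k, h1, ?_, h3⟩
      by_contra hk
      obtain rfl : k = L + 1 := by omega
      have hab := hmin b hb.1
      unfold NearBlock at *
      omega
    · rw [Finset.mem_filter] at hb hc
      obtain ⟨k, h1, h2, h3⟩ := h b hb.1 c hc.1 hbc
      refine ⟨k, h1, ?_, h3⟩
      by_contra hk
      obtain rfl : k = L + 1 := by omega
      have hab := hmin b hb.1
      obtain ⟨k', h1', h2', h3'⟩ := h a haS c hc.1 (by omega)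
      have hk' : k' ≠ L + 1 := by
        rintro rfl
        exact hc.2 h3'
      have hsep := two_pow_separated h1' (show k' < L + 1 by omega)
      unfold NearBlock at *
      omega

variable {𝕜 : Type*} [RCLike 𝕜] {w β : ℤ → ℝ} {T : ℓ²(ℤ, 𝕜) →L[𝕜] ℓ²(ℤ, 𝕜)}

/-- The multiples `c ∈ A` for which the `n`-th iterate of `c T` at `x` is close to `e₀`. -/
def closeMultiples (T : ℓ²(ℤ, 𝕜) →L[𝕜] ℓ²(ℤ, 𝕜)) (x : ℓ²(ℤ, 𝕜)) (A : Set ℝ) (n : ℕ) : Set ℝ :=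
  {c | c ∈ A ∧ ‖(((c : 𝕜) • T) ^ n) x - lp.single 2 0 (1 : 𝕜)‖ < 1 / 2}

theorem norm_apply_sub_apply_le (y z : ℓ²(ℤ, 𝕜)) (i : ℤ) : ‖y i - z i‖ ≤ ‖y - z‖ :=
  lp.norm_apply_le_norm (by norm_num) (y - z) i

theorem IsWeightProduct.closeMultiples_coord_zero (hβ : IsWeightProduct w β)
    (hT : ∀ x n, T x n = (w (n + 1) : 𝕜) * x (n + 1)) {x : ℓ²(ℤ, 𝕜)} {A : Set ℝ}
    (hA : A ⊆ Set.Ici 0) {c : ℝ} {n : ℕ} (hc : c ∈ closeMultiples T x A n) :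
    1 / 2 < c ^ n * (β n * ‖x n‖) ∧ c ^ n * (β n * ‖x n‖) < 3 / 2 := by
  obtain ⟨hc1, hc2⟩ := hc
  have hc0 : 0 ≤ c := Set.mem_Ici.1 (hA hc1)
  have hβn := hβ.pos n
  have h := (norm_apply_sub_apply_le ((((c : 𝕜) • T) ^ n) x) (lp.single 2 0 (1 : 𝕜)) 0).trans_lt hc2
  rw [lp.single_apply_self] at h
  have hn : ‖((((c : 𝕜) • T) ^ n) x) 0‖ = c ^ n * (β n * ‖x n‖) := by
    rw [hβ.pow_apply hT, norm_mul, RCLike.norm_ofReal, zero_add, hβ.zero, div_one,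
      abs_of_nonneg (by positivity), mul_assoc]
  have h1 := norm_sub_norm_le (1 : 𝕜) (((((c : 𝕜) • T) ^ n) x) 0)
  have h2 := norm_sub_norm_le (((((c : 𝕜) • T) ^ n) x) 0) (1 : 𝕜)
  rw [norm_sub_rev, norm_one, hn] at h1
  rw [norm_one, hn] at h2
  constructor <;> linarith

theorem IsWeightProduct.closeMultiples_coord (hβ : IsWeightProduct w β)
    (hT : ∀ x n, T x n = (w (n + 1) : 𝕜) * x (n + 1)) {x : ℓ²(ℤ, 𝕜)} {A : Set ℝ}
    (hA : A ⊆ Set.Ici 0) {c : ℝ} {n : ℕ} (hc : c ∈ closeMultiples T x A n) {j : ℤ} (hj : j ≠ 0)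
    (hβj : β j = 1) :
    c ^ n * (β (j + n) * ‖x (j + n)‖) < 1 / 2 := by
  obtain ⟨hc1, hc2⟩ := hc
  have hc0 : 0 ≤ c := Set.mem_Ici.1 (hA hc1)
  have hβn := hβ.pos (j + n)
  have h := (norm_apply_sub_apply_le ((((c : 𝕜) • T) ^ n) x) (lp.single 2 0 (1 : 𝕜)) j).trans_lt hc2
  rwa [lp.single_apply_ne _ _ _ hj, sub_zero, hβ.pow_apply hT, norm_mul,
    RCLike.norm_ofReal, hβj, div_one, abs_of_nonneg (by positivity), mul_assoc] at h

/-- If `β j = β (-j) = 1`, coordinates `0` and `j` at time `n` give `β (j + n) * ‖x (j + n)‖ < β n *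
‖x n‖`, and coordinates `0` and `-j` at time `j + n` give the reverse inequality. The multiples `c`
and `d` may differ, since each comparison is made within one iterate. -/
theorem IsWeightProduct.ne_one_of_closeMultiples (hβ : IsWeightProduct w β)
    (hT : ∀ x n, T x n = (w (n + 1) : 𝕜) * x (n + 1)) {x : ℓ²(ℤ, 𝕜)} {A : Set ℝ}
    (hA : A ⊆ Set.Ici 0) {n j : ℕ} (hj : 0 < j) (h1 : (closeMultiples T x A n).Nonempty)
    (h2 : (closeMultiples T x A (j + n)).Nonempty) : β j ≠ 1 ∨ β (-j) ≠ 1 := by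
  by_contra! h
  obtain ⟨c, hc⟩ := h1
  obtain ⟨d, hd⟩ := h2
  have e1 := (hβ.closeMultiples_coord_zero hT hA hc).1
  have e2 := hβ.closeMultiples_coord hT hA hc (j := j) (by omega) h.1
  have e3 := (hβ.closeMultiples_coord_zero hT hA hd).1
  have e4 := hβ.closeMultiples_coord hT hA hd (j := -j) (by omega) h.2
  push_cast at e3 e4
  rw [neg_add_cancel_left] at e4
  have hcn : 0 ≤ c ^ n := pow_nonneg (Set.mem_Ici.1 (hA hc.1)) n
  have hdn : 0 ≤ d ^ (j + n) := pow_nonneg (Set.mem_Ici.1 (hA hd.1)) _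
  have h3 := lt_of_mul_lt_mul_left (e2.trans e1) hcn
  have h4 := lt_of_mul_lt_mul_left (e4.trans e3) hdn
  exact lt_asymm h3 h4

/-- Coordinate `0` confines `c ^ n` to an interval whose endpoints have ratio `3`. By Bernoulli's
inequality two such multiples have ratio at most `1 + 2 / n`, so with `c ≤ 2` they differ by at most
`4 / n`. -/
theorem IsWeightProduct.volume_closeMultiples_le (hβ : IsWeightProduct w β)
    (hT : ∀ x n, T x n = (w (n + 1) : 𝕜) * x (n + 1)) {x : ℓ²(ℤ, 𝕜)} {A : Set ℝ}
    (hA : A ⊆ Set.Ici 0) (hA2 : ∀ c ∈ A, c ≤ 2) {n : ℕ} (hn : 0 < n) :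
    MeasureTheory.volume (closeMultiples T x A n) ≤ ENNReal.ofReal (4 / n) := by
  have hn' : (0 : ℝ) < n := by exact_mod_cast hn
  have key : ∀ c ∈ closeMultiples T x A n, ∀ d ∈ closeMultiples T x A n, d - c ≤ 4 / n := by
    intro c hc d hd
    obtain ⟨h1, -⟩ := hβ.closeMultiples_coord_zero hT hA hc
    obtain ⟨-, h2⟩ := hβ.closeMultiples_coord_zero hT hA hd
    have hc0 : 0 < c := by
      refine lt_of_le_of_ne (Set.mem_Ici.1 (hA hc.1)) fun h => ?_
      rw [← h, zero_pow hn.ne'] at h1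
      linarith
    have hd0 : 0 ≤ d := Set.mem_Ici.1 (hA hd.1)
    set p := β n * ‖x n‖
    have hp : 0 < p := by
      by_contra! hp
      have := mul_nonpos_of_nonneg_of_nonpos (pow_pos hc0 n).le hp
      linarith
    have h3 : d ^ n < 3 * c ^ n := by
      by_contra! h
      have := mul_le_mul_of_nonneg_right h hp.le
      linarith
    have h4 : (d / c) ^ n < 3 := by
      rw [div_pow, div_lt_iff₀ (by positivity)]; exact h3
    have h5 := one_add_mul_le_pow (a := d / c - 1)
      (by have : 0 ≤ d / c := by positivity
          linarith) n
    rw [add_sub_cancel] at h5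
    have h6 : n * (d / c - 1) ≤ 2 := by linarith
    rw [le_div_iff₀ hn']
    have h7 : (d - c) * n = c * (n * (d / c - 1)) := by field_simp
    rw [h7]
    nlinarith [hA2 c hc.1]
  refine (Real.volume_le_diam _).trans (Metric.ediam_le fun c hc d hd => ?_)
  rw [edist_dist, Real.dist_eq]
  exact ENNReal.ofReal_le_ofReal (abs_le.2 ⟨by linarith [key c hc d hd], key d hd c hc⟩)

/-- Borel–Cantelli over the blocks `l`: at most `2 ^ l` visit times, each covering measure at most
`5 / 8 ^ l`. -/
theorem volume_eq_zero_of_hasCommonHypercyclicVector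
    (hT : ∀ x n, T x n = (weightII (n + 1) : 𝕜) * x (n + 1)) {A : Set ℝ} (hA : A ⊆ Set.Ici 0)
    (hA2 : ∀ c ∈ A, c ≤ 2) (h : HasCommonHypercyclicVector T A) :
    MeasureTheory.volume A = 0 := by
  classical
  obtain ⟨x, hx⟩ := h
  rcases A.eq_empty_or_nonempty with rfl | ⟨a, ha⟩
  · simp
  have hβ := isWeightProduct_productII
  have hvisit : ∀ c ∈ A, ∀ N, ∃ n, N ≤ n ∧ c ∈ closeMultiples T x A n := fun c hc N => by
    obtain ⟨n, hn, hn'⟩ := (hx c hc).exists_ge_norm_sub_lt (lp.single 2 0 (1 : 𝕜)) one_half_pos N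
    exact ⟨n, hn, hc, hn'⟩
  obtain ⟨g, -, hg⟩ := hvisit a ha 0
  have hdiff : ∀ b c, b < c → (closeMultiples T x A b).Nonempty →
      (closeMultiples T x A c).Nonempty → ∃ k, 1 ≤ k ∧ NearBlock k (c - b) := by
    intro b c hbc hb hc
    exact exists_nearBlock (hβ.ne_one_of_closeMultiples hT hA (by omega) hb
      (by rwa [Nat.sub_add_cancel hbc.le]))
  -- Visit times whose delay after the reference visit `g` is near block `l`. The range is only a
  -- crude bound that makes the set finite.
  let B : ℕ → Finset ℕ := fun l => (Finset.range (g + 2 * 2 ^ (3 * l ^ 2) + 1)).filter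
    fun b => g < b ∧ (closeMultiples T x A b).Nonempty ∧ NearBlock l (b - g)
  have hB : ∀ l b, b ∈ B l ↔ g < b ∧ (closeMultiples T x A b).Nonempty ∧ NearBlock l (b - g) := by
    intro l b
    simp only [B, Finset.mem_filter, Finset.mem_range, and_iff_right_iff_imp]
    rintro ⟨h1, -, h2⟩
    unfold NearBlock at h2
    omega
  have hcard : ∀ l, (B l).card ≤ 2 ^ l := by
    intro l
    refine card_le_two_pow_of_nearBlock l _ fun b hb c hc hbc => ?_
    rw [hB] at hb hc
    obtain ⟨k, hk, hk'⟩ := hdiff b c hbc hb.2.1 hc.2.1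
    refine ⟨k, hk, ?_, hk'⟩
    by_contra! hlk
    have hmono : 2 ^ (3 * l ^ 2) ≤ 2 ^ (3 * k ^ 2) :=
      Nat.pow_le_pow_right (by norm_num) (by gcongr)
    have hpos : 0 < 2 ^ (3 * l ^ 2) := by positivity
    unfold NearBlock at *
    omega
  have hvol : ∀ l, MeasureTheory.volume {c | ∃ b ∈ B l, c ∈ closeMultiples T x A b}
      ≤ ENNReal.ofReal (5 * (1 / 4) ^ l) := by
    intro l
    have hset : {c | ∃ b ∈ B l, c ∈ closeMultiples T x A b}
        = ⋃ b ∈ B l, closeMultiples T x A b := by ext c; simp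
    rw [hset]
    have hterm : ∀ b ∈ B l, MeasureTheory.volume (closeMultiples T x A b)
        ≤ ENNReal.ofReal (5 / 8 ^ l) := by
      intro b hb
      rw [hB] at hb
      refine (hβ.volume_closeMultiples_le hT hA hA2 (by omega)).trans (ENNReal.ofReal_le_ofReal ?_)
      -- Since `b ≥ 7/8 * 8 ^ l`, the bound `4 / b` is at most `32 / (7 * 8 ^ l)`, and `32 / 7 ≤ 5`.
      have h1 : 8 ^ l ≤ 2 ^ (3 * l ^ 2) := by
        rw [show 8 = 2 ^ 3 by norm_num, ← pow_mul]
        exact Nat.pow_le_pow_right (by norm_num) (by nlinarith [Nat.le_self_pow two_ne_zero l])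
      have h2 : 7 * 8 ^ l ≤ 8 * b := by
        have := hb.2.2.1
        omega
      have h3 : (7 : ℝ) * 8 ^ l ≤ 8 * b := by exact_mod_cast h2
      have h4 : (0 : ℝ) < b := by exact_mod_cast (show 0 < b by omega)
      rw [div_le_div_iff₀ h4 (by positivity)]
      linarith
    calc MeasureTheory.volume (⋃ b ∈ B l, closeMultiples T x A b)
        ≤ ∑ b ∈ B l, MeasureTheory.volume (closeMultiples T x A b) :=
          MeasureTheory.measure_biUnion_finset_le _ _
      _ ≤ (B l).card • ENNReal.ofReal (5 / 8 ^ l) := Finset.sum_le_card_nsmul _ _ _ hterm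
      _ = ENNReal.ofReal ((B l).card * (5 / 8 ^ l)) := by
          rw [ENNReal.ofReal_mul (by positivity), ENNReal.ofReal_natCast, nsmul_eq_mul]
      _ ≤ ENNReal.ofReal (2 ^ l * (5 / 8 ^ l)) := by
          have : ((B l).card : ℝ) ≤ 2 ^ l := by exact_mod_cast hcard l
          gcongr
      _ = ENNReal.ofReal (5 * (1 / 4) ^ l) := by
          congr 1
          rw [show (8 : ℝ) = 2 * 4 by norm_num, mul_pow]
          rw [one_div, inv_pow]
          field_simp
  have hsum : ∑' l, MeasureTheory.volume {c | ∃ b ∈ B l, c ∈ closeMultiples T x A b} ≠ ⊤ := by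
    refine ne_top_of_le_ne_top ?_ (ENNReal.tsum_le_tsum hvol)
    rw [← ENNReal.ofReal_tsum_of_nonneg (fun l => by positivity)
      ((summable_geometric_of_lt_one (by norm_num) (by norm_num)).mul_left 5)]
    exact ENNReal.ofReal_ne_top
  refine MeasureTheory.measure_mono_null (fun c hc => ?_)
    (MeasureTheory.measure_setOfPred_frequently_eq_zero hsum)
  refine frequently_atTop.2 fun L => ?_
  -- A visit this late cannot have its delay near a block of index at most `L`, because such a delay
  -- is at most `9/8` of the centre.
  obtain ⟨n, hn, hcn⟩ := hvisit c hc (g + 2 * 2 ^ (3 * L ^ 2))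
  have hpos : 0 < 2 ^ (3 * L ^ 2) := by positivity
  obtain ⟨l, hl, hnear⟩ := hdiff g n (by omega) ⟨a, hg⟩ ⟨c, hcn⟩
  refine ⟨l, ?_, n, (hB l n).2 ⟨by omega, ⟨c, hcn⟩, hnear⟩, hcn⟩
  by_contra! hlL
  have hmono : 2 ^ (3 * l ^ 2) ≤ 2 ^ (3 * L ^ 2) :=
    Nat.pow_le_pow_right (by norm_num) (by gcongr)
  have := hnear.2
  omega

end NullSet

/-! ### The second shift, and the transfer of both shifts to `ℓ²(ℕ)` -/

theorem exists_shift_hypercyclicMultiples_eq_Ioo (𝕜 : Type*) [RCLike 𝕜] :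
    ∃ T : ℓ²(ℤ, 𝕜) →L[𝕜] ℓ²(ℤ, 𝕜), IsBilateralWeightedShift weightII T ∧ IsUnit T ∧
      hypercyclicMultiples T = Set.Ioo (1 / 2) 2 ∧
      ∀ A : Set ℝ, A ⊆ Set.Ici 0 → HasCommonHypercyclicVector T A →
        MeasureTheory.volume A = 0 := by
  have hw := fun n => (weightII_mem n).1
  have hw' := fun n => (weightII_mem n).2
  obtain ⟨T, hT, hunit⟩ := exists_invertible_shift (𝕜 := 𝕜) (by norm_num) hw hw'
  have hM : hypercyclicMultiples T = Set.Ioo (1 / 2) 2 := by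
    ext c
    simp only [hypercyclicMultiples, Set.mem_ofPred_eq, Set.mem_Ioo]
    constructor
    · rintro ⟨hc, h⟩
      by_contra hne
      obtain ⟨M, hM⟩ := productII_bounded hc (by
        by_contra! h'
        exact hne h')
      obtain ⟨n, h1, h2⟩ := isWeightProduct_productII.unbounded_of_isHypercyclic hT hc h M
      rcases hM n with h | h <;> linarith
    · rintro ⟨h1, h2⟩
      have hc : 0 < c := by linarith
      exact ⟨hc, isWeightProduct_productII.isHypercyclic_of_unbounded hT hunit (by norm_num)
        hw hw' hc (productII_unbounded h1 h2)⟩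
  refine ⟨T, isBilateralWeightedShift_of_apply hT, hunit, hM, fun A hA h => ?_⟩
  -- The required bound `c ≤ 2` comes from the computed set of hypercyclic multiples, which covers
  -- positive `c` only; `c = 0` is treated apart.
  refine volume_eq_zero_of_hasCommonHypercyclicVector hT hA (fun c hc => ?_) h
  rcases (Set.mem_Ici.1 (hA hc)).eq_or_lt with h0 | h0
  · linarith
  · obtain ⟨x, hx⟩ := h
    have : c ∈ hypercyclicMultiples T := ⟨h0, x, hx c hc⟩
    rw [hM] at this
    exact this.2.le

theorem theorem5 (𝕜 : Type*) [RCLike 𝕜] :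
    -- the two parts on `ℓ₂ = ℓ²(ℕ)`
    ((∃ S : ℓ²(ℕ, 𝕜) →L[𝕜] ℓ²(ℕ, 𝕜), hypercyclicMultiples S = {1, 2}) ∧
      (∃ T : ℓ²(ℕ, 𝕜) →L[𝕜] ℓ²(ℕ, 𝕜), hypercyclicMultiples T = Set.Ioo (1 / 2) 2 ∧
        ∀ A : Set ℝ, A ⊆ Set.Ici 0 → HasCommonHypercyclicVector T A →
          MeasureTheory.volume A = 0)) ∧
    -- the two parts for explicit invertible bilateral weighted shifts on `ℓ²(ℤ)`
    ((∃ S : ℓ²(ℤ, 𝕜) →L[𝕜] ℓ²(ℤ, 𝕜), IsBilateralWeightedShift weightI S ∧ IsUnit S ∧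
        hypercyclicMultiples S = {1, 2}) ∧
      (∃ T : ℓ²(ℤ, 𝕜) →L[𝕜] ℓ²(ℤ, 𝕜), IsBilateralWeightedShift weightII T ∧ IsUnit T ∧
        hypercyclicMultiples T = Set.Ioo (1 / 2) 2 ∧
        ∀ A : Set ℝ, A ⊆ Set.Ici 0 → HasCommonHypercyclicVector T A →
          MeasureTheory.volume A = 0)) := by
  obtain ⟨S, hS, hSu, hSM⟩ := exists_shift_hypercyclicMultiples_eq_one_two 𝕜
  obtain ⟨T, hT, hTu, hTM, hTA⟩ := exists_shift_hypercyclicMultiples_eq_Ioo 𝕜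
  -- Any bijection between `ℤ` and `ℕ` will do, as all the properties are invariant under
  -- conjugation by an isomorphism.
  obtain ⟨e⟩ := nonempty_reindex (𝕜 := 𝕜) (Denumerable.eqv ℤ).symm
  refine ⟨⟨⟨_, (hypercyclicMultiples_conj e S).trans hSM⟩,
    ⟨_, (hypercyclicMultiples_conj e T).trans hTM, fun A hA h => hTA A hA h.of_conj⟩⟩,
    ⟨S, hS, hSu, hSM⟩, T, hT, hTu, hTM, hTA⟩
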